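/- An instance of \textsc{Envy Elimination by Adding Goods} consists of finite sets $A$ of agents, $P$ of initial items and $R$ of additional items, a supply $\mathrm{supply}(r)\in\mathbb{N}\cup\{\infty\}$ for each $r\in R$, a valuation $v_a\colon P\cup R\to\mathbb{N}$ for each agent $a\in A$ (extended additively to bundles), pairwise disjoint initial bundles $\sigma(a)\subseteq P$ for $a\in A$, and a budget $k\in\mathbb{N}\cup\{\infty\}$, where $k=\infty$ means that the budget is unbounded. An extension is a map $\rho\colon A\times R\to\mathbb{N}$ with $\sum_{a\in A}\rho(a,r)\le \mathrm{supply}(r)$ for every $r\in R$. It resolves envy if \[ v_a(\sigma(a))+\sum_{r\in R}\rho(a,r)\,v_a(r)\;\ge\; v_a(\sigma(a'))+\sum_{r\in R}\rho(a',r)\,v_a(r)\qquad\text{for all } a,a'\in A. \] The question is whether there is an extension $\rho$ that resolves envy and satisfies $\sum_{a\in A}\sum_{r\in R}\rho(a,r)\le k$. Theorem. \textsc{Envy Elimination by Adding Goods}, restricted to the instances in which $\mathrm{supply}(r)=\infty$ for all $r\in R$ and $k=\infty$, is solvable in polynomial time: there are a random access machine program (with integer registers and memory, the operations $+,-,\cdot$,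 integer division and remainder, and logarithmic cost, i.e. every number handled is charged its bit length plus one) and a polynomial $p$ such that on every such instance the program halts after time at most $p(s)$ and accepts if and only if the answer to the question is yes. Here $s$ is the size of the instance, which lists the sets $A,P,R$ and all numbers in binary. -/

import Mathlib

/-! ### Random access machine with logarithmic cost

A machine has registers `reg 0, reg 1, …` and a memory addressed by integers; both hold integers.
A program is a finite while-program over the basic instructions of a random access machine.
Every integer that is computed or read is charged its bit length (plus one), so that polynomial
time below means polynomial time in the bit model (equivalently, on a Turing machine). -/

namespace RAM

/-- Contents of the registers and of the memory. -/
structure State where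
  reg : ℕ → ℤ
  mem : ℤ → ℤ

/-- The arithmetic operations. Division and remainder are those of `ℤ` in Mathlib (rounding down
for a positive divisor; `x / 0 = 0` and `x % 0 = x`). -/
inductive Op where
  | add | sub | mul | div | mod

def Op.apply : Op → ℤ → ℤ → ℤ
  | .add, x, y => x + y
  | .sub, x, y => x - y
  | .mul, x, y => x * y
  | .div, x, y => x / y
  | .mod, x, y => x % y

/-- Arithmetic expressions: constants, register contents, memory contents at a computed address,
and arithmetic operations. -/
inductive Expr where
  | const (c : ℤ)
  | reg (i : ℕ)
  | mem (address : Expr)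
  | op (o : Op) (e₁ e₂ : Expr)

def Expr.eval (s : State) : Expr → ℤ
  | .const c => c
  | .reg i => s.reg i
  | .mem a => s.mem (a.eval s)
  | .op o e₁ e₂ => o.apply (e₁.eval s) (e₂.eval s)

/-- The cost of handling one integer: its bit length plus one. -/
def intCost (x : ℤ) : ℕ := Nat.size x.natAbs + 1

/-- The cost of evaluating an expression: the costs of the values of all its subexpressions. -/
def Expr.cost (s : State) : Expr → ℕ
  | .const c => intCost c
  | .reg i => intCost (s.reg i)
  | .mem a => a.cost s + intCost (s.mem (a.eval s))
  | .op o e₁ e₂ =>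
      e₁.cost s + e₂.cost s + intCost (o.apply (e₁.eval s) (e₂.eval s))

/-- Programs. Conditions test whether the value of an expression is positive. -/
inductive Prog where
  | skip
  | assign (i : ℕ) (e : Expr)
  | store (address e : Expr)
  | seq (c₁ c₂ : Prog)
  | ite (e : Expr) (c₁ c₂ : Prog)
  | loop (e : Expr) (c : Prog)

/-- `Run c s t s'`: started in the state `s`, the program `c` halts, in the state `s'`, and its
running time is `t`. (`loop e c` repeats `c` as long as `e` is positive.) -/
inductive Run : Prog → State → ℕ → State → Prop where
  | skip (s : State) : Run .skip s 1 s
  | assign (i : ℕ) (e : Expr) (s : State) :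
      Run (.assign i e) s (e.cost s + 1) { s with reg := Function.update s.reg i (e.eval s) }
  | store (a e : Expr) (s : State) :
      Run (.store a e) s (a.cost s + e.cost s + 1)
        { s with mem := Function.update s.mem (a.eval s) (e.eval s) }
  | seq {c₁ c₂ : Prog} {s s' s'' : State} {t₁ t₂ : ℕ} :
      Run c₁ s t₁ s' → Run c₂ s' t₂ s'' → Run (.seq c₁ c₂) s (t₁ + t₂ + 1) s''
  | ite_pos {e : Expr} {c₁ c₂ : Prog} {s s' : State} {t : ℕ} :
      0 < e.eval s → Run c₁ s t s' → Run (.ite e c₁ c₂) s (e.cost s + t + 1) s'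
  | ite_nonpos {e : Expr} {c₁ c₂ : Prog} {s s' : State} {t : ℕ} :
      e.eval s ≤ 0 → Run c₂ s t s' → Run (.ite e c₁ c₂) s (e.cost s + t + 1) s'
  | loop_pos {e : Expr} {c : Prog} {s s' s'' : State} {t₁ t₂ : ℕ} :
      0 < e.eval s → Run c s t₁ s' → Run (.loop e c) s' t₂ s'' →
        Run (.loop e c) s (e.cost s + t₁ + t₂ + 1) s''
  | loop_nonpos {e : Expr} {c : Prog} {s : State} :
      e.eval s ≤ 0 → Run (.loop e c) s (e.cost s + 1) s

/-- The initial state on an input `x₀, …, x_{L-1}`: memory cell `j < L` holds `x_j`, register `0`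
holds the length `L`, everything else is `0`. -/
def init (x : List ℕ) : State where
  reg i := if i = 0 then (x.length : ℤ) else 0
  mem j := if 0 ≤ j then ((x.getD j.toNat 0 : ℕ) : ℤ) else 0

/-- The size of an input: the total bit length of its entries, plus one for each entry. -/
def inputSize (x : List ℕ) : ℕ := (x.map fun a => Nat.size a + 1).sum

/-- The decision problem `yes` on the objects satisfying `promise`, presented to the machine
through `encode`, is solvable in polynomial time: one program halts on every such object within
a time polynomial in the size of the input, and accepts (halts with `1` in register `0`)
exactly the yes-objects. -/
def PolyTimeDecidable {α : Type*} (encode : α → List ℕ) (promise yes : α → Prop) : Prop :=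
  ∃ (c : Prog) (p : Polynomial ℕ), ∀ I : α, promise I →
    ∃ (t : ℕ) (s : State), Run c (init (encode I)) t s ∧
      t ≤ p.eval (inputSize (encode I)) ∧ (s.reg 0 = 1 ↔ yes I)

end RAM

/-! ### Envy Elimination by Adding Goods -/

namespace EnvyElimination

/-- An instance. The agents are `Fin n`, the initial items `P = Fin p` (copies of the same item
are distinct elements), the additional items `R = Fin m`. The initial allocation need not allocate
all initial items. -/
structure Inst where
  n : ℕ
  p : ℕ
  m : ℕ
  /-- the number of available copies of each additional item -/
  supply : Fin m → ℕ∞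
  /-- the valuations of single items -/
  v : Fin n → Fin p ⊕ Fin m → ℕ
  /-- the initial bundles -/
  σ : Fin n → Finset (Fin p)
  σ_disjoint : ∀ a b : Fin n, a ≠ b → Disjoint (σ a) (σ b)
  /-- the budget `k`; `⊤` means that the budget is unbounded -/
  budget : ℕ∞

namespace Inst

variable (I : Inst)

/-- The value that agent `a` assigns to the initial bundle of agent `b`. -/
def initialValue (a b : Fin I.n) : ℕ := ∑ j ∈ I.σ b, I.v a (Sum.inl j)

/-- The value that agent `a` assigns to what agent `b` gets from `ρ`. -/
def addedValue (ρ : Fin I.n → Fin I.m → ℕ) (a b : Fin I.n) : ℕ :=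
  ∑ r, ρ b r * I.v a (Sum.inr r)

/-- `ρ a r` copies of `r` go to agent `a`, within the supply. -/
def IsExtension (ρ : Fin I.n → Fin I.m → ℕ) : Prop :=
  ∀ r, ((∑ a, ρ a r : ℕ) : ℕ∞) ≤ I.supply r

/-- The number of items that `ρ` allocates. -/
def extensionSize (ρ : Fin I.n → Fin I.m → ℕ) : ℕ := ∑ a, ∑ r, ρ a r

/-- Agent `a` envies agent `b` in the allocation extended by `ρ`. -/
def Envies (ρ : Fin I.n → Fin I.m → ℕ) (a b : Fin I.n) : Prop :=
  I.initialValue a a + I.addedValue ρ a a < I.initialValue a b + I.addedValue ρ a b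

def EnvyFree (ρ : Fin I.n → Fin I.m → ℕ) : Prop := ∀ a b, ¬ I.Envies ρ a b

/-- The question of the problem: is there an envy-resolving extension within the budget? -/
def IsYes : Prop :=
  ∃ ρ : Fin I.n → Fin I.m → ℕ,
    I.IsExtension ρ ∧ ((I.extensionSize ρ : ℕ) : ℕ∞) ≤ I.budget ∧ I.EnvyFree ρ

/-- Code of an element of `ℕ ∪ {∞}`: `0` for `∞` and `k + 1` for `k`. -/
noncomputable def codeENat (k : ℕ∞) : ℕ := if k = ⊤ then 0 else k.toNat + 1

/-- A matrix, written row by row. -/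
def rowMajor {a b : ℕ} (M : Fin a → Fin b → ℕ) : List ℕ :=
  List.ofFn fun k : Fin (a * b) => M k.divNat k.modNat

/-- The input that the machine receives: the numbers of agents, initial items and additional items,
the budget, the supplies, the valuations of the initial and of the additional items, and the
incidence matrix of the initial bundles; finally the lists of all agents and items by their names
`0, 1, …`, so that the three sets are listed explicitly even where an instance has no valuations.
All numbers are presented in binary, see `RAM.inputSize`. -/
noncomputable def encode : List ℕ :=
  [I.n, I.p, I.m, codeENat I.budget]
    ++ List.ofFn (fun r => codeENat (I.supply r))
    ++ rowMajor (fun a j => I.v a (Sum.inl j))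
    ++ rowMajor (fun a r => I.v a (Sum.inr r))
    ++ rowMajor (fun a j => if j ∈ I.σ a then 1 else 0)
    ++ List.range I.n ++ List.range I.p ++ List.range I.m

end Inst

end EnvyElimination

/-! Let `g a` be the gcd of agent `a`'s values for the additional items. If `g a = 0`, no extension
changes what `a` sees, so `a` must be free of initial envy. Envy between agents with nonproportional
valuations can always be outweighed. The quadratic scoring rule is strictly proper, so it gives each
agent with `g a > 0` an integral bundle which that agent strictly prefers to the bundle of every
agent not proportional to it (`exists_strictly_proper_bundles`). A large multiple of these bundles
swamps the initial envy and every bounded correction.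

Proportional agents receive the same such bundle, so only the corrections matter between them. In
units of `g a`, all agents of a class value a bundle alike, at an integer, and by Bezout every
integer occurs as the value of an integral correction. The large multiple also makes all entries
nonnegative. What remains is an integral system `y a - y b ≥ ⌈d a b / g a⌉` inside each class, where
`d` is the initial envy (`exists_extension_iff`). It is solvable iff no cycle has positive weight,
which is read off the diagonal of a Floyd-Warshall recursion (`exists_potential_iff`). Together
these give `isYes_iff_criterion`.

The machine computes the criterion by filling six arrays, each by a recurrence: prefix gcds, envies,
deviations from proportionality, the relation, the longest-path table and a count of violations.
Array lengths and the bit lengths of all entries are at most `bits`, a polynomial in the input size;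
for the path table this is `abs_longest_le`. A fixed expression costs linear time in the bit length
of the state (`Expr.exists_cost_le`), and a phase makes at most `bits` rounds, each dominated by one
quadratic run of Euclid's algorithm (`fill_spec`, `phase_spec`). -/

namespace RAM

/-! ### Bit lengths and running times of programs -/

/-- Running `c` from `s` ends in `s'` after at most `T` time units. -/
def RunsIn (c : Prog) (s : State) (T : ℕ) (s' : State) : Prop := ∃ t ≤ T, Run c s t s'

/-- Every register and every memory cell has at most `B` bits. -/
def State.Bounded (B : ℕ) (s : State) : Prop :=
  (∀ i, (s.reg i).natAbs < 2 ^ B) ∧ ∀ j, (s.mem j).natAbs < 2 ^ B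

def State.setReg (s : State) (i : ℕ) (x : ℤ) : State := { s with reg := Function.update s.reg i x }

def State.setMem (s : State) (a x : ℤ) : State := { s with mem := Function.update s.mem a x }

@[simp] lemma State.setReg_mem (s : State) (i : ℕ) (x : ℤ) : (s.setReg i x).mem = s.mem := rfl

@[simp] lemma State.setMem_reg (s : State) (a x : ℤ) : (s.setMem a x).reg = s.reg := rfl

lemma State.setReg_reg (s : State) (i j : ℕ) (x : ℤ) :
    (s.setReg i x).reg j = if j = i then x else s.reg j := by
  simp [State.setReg, Function.update_apply]

lemma State.setMem_mem (s : State) (a b x : ℤ) :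
    (s.setMem a x).mem b = if b = a then x else s.mem b := by
  simp [State.setMem, Function.update_apply]

lemma State.Bounded.setReg {B : ℕ} {s : State} (h : s.Bounded B) (i : ℕ) {x : ℤ}
    (hx : x.natAbs < 2 ^ B) : (s.setReg i x).Bounded B := by
  refine ⟨fun j => ?_, h.2⟩
  rw [State.setReg_reg]
  split_ifs
  · exact hx
  · exact h.1 j

lemma State.Bounded.setMem {B : ℕ} {s : State} (h : s.Bounded B) (a : ℤ) {x : ℤ}
    (hx : x.natAbs < 2 ^ B) : (s.setMem a x).Bounded B := by
  refine ⟨h.1, fun j => ?_⟩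
  rw [State.setMem_mem]
  split_ifs
  · exact hx
  · exact h.2 j

lemma intCost_le_iff {x : ℤ} {B : ℕ} : intCost x ≤ B + 1 ↔ x.natAbs < 2 ^ B := by
  simp [intCost, Nat.size_le]

/-- A product has at most the sum of the bit lengths, and the extra unit in each `intCost` pays for
the carry of a sum or difference. Additivity is what makes fixed expressions linear in the bit
length. -/
lemma intCost_apply_le (o : Op) (x y : ℤ) : intCost (o.apply x y) ≤ intCost x + intCost y := by
  have hx : x.natAbs < 2 ^ Nat.size x.natAbs := Nat.lt_size_self _
  have hy : y.natAbs < 2 ^ Nat.size y.natAbs := Nat.lt_size_self _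
  have key : (o.apply x y).natAbs < 2 ^ (Nat.size x.natAbs + Nat.size y.natAbs + 1) := by
    generalize Nat.size x.natAbs = a at *
    generalize Nat.size y.natAbs = b at *
    have h1 : 2 ^ a ≤ 2 ^ (a + b) := Nat.pow_le_pow_right (by norm_num) (by omega)
    have h2 : 2 ^ b ≤ 2 ^ (a + b) := Nat.pow_le_pow_right (by norm_num) (by omega)
    have h3 : 2 ^ (a + b + 1) = 2 * 2 ^ (a + b) := by ring
    cases o with
    | add => simp only [Op.apply]; omega
    | sub => simp only [Op.apply]; omega
    | mul =>
      simp only [Op.apply, Int.natAbs_mul]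
      calc x.natAbs * y.natAbs < 2 ^ a * 2 ^ b := Nat.mul_lt_mul'' hx hy
        _ = 2 ^ (a + b) := by ring
        _ ≤ _ := by omega
    | div =>
      have := Int.natAbs_ediv_le_natAbs x y
      simp only [Op.apply]; omega
    | mod =>
      simp only [Op.apply]
      rcases eq_or_ne y 0 with rfl | hy0
      · simp only [Int.emod_zero]; omega
      · have h4 := Int.emod_nonneg x hy0
        have h5 := Int.emod_lt_abs x hy0
        rw [Int.abs_eq_natAbs] at h5
        omega
  have := intCost_le_iff.2 key
  simp only [intCost] at *
  omega

/-- The cost of evaluating a fixed expression is linear in the bit length of the state. -/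
lemma Expr.exists_cost_le (e : Expr) : ∃ K, ∀ B s, State.Bounded B s →
    intCost (e.eval s) ≤ K * (B + 1) ∧ e.cost s ≤ K * (B + 1) := by
  induction e with
  | const c =>
    refine ⟨intCost c, fun B s _ => ?_⟩
    simp only [Expr.eval, Expr.cost, and_self]
    exact Nat.le_mul_of_pos_right _ (by omega)
  | reg i =>
    refine ⟨1, fun B s h => ?_⟩
    simp only [Expr.eval, Expr.cost, and_self, one_mul]
    exact intCost_le_iff.2 (h.1 i)
  | mem a ih =>
    obtain ⟨K, hK⟩ := ih
    refine ⟨K + 1, fun B s h => ?_⟩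
    have h1 := (hK B s h).2
    have h2 := intCost_le_iff.2 (h.2 (a.eval s))
    simp only [Expr.eval, Expr.cost, add_mul, one_mul]
    constructor <;> nlinarith
  | op o e₁ e₂ ih₁ ih₂ =>
    obtain ⟨K₁, h₁⟩ := ih₁
    obtain ⟨K₂, h₂⟩ := ih₂
    refine ⟨2 * (K₁ + K₂), fun B s h => ?_⟩
    have a₁ := h₁ B s h
    have a₂ := h₂ B s h
    have := intCost_apply_le o (e₁.eval s) (e₂.eval s)
    simp only [Expr.eval, Expr.cost]
    constructor <;> nlinarith

lemma RunsIn.mono {c : Prog} {s s' : State} {T T' : ℕ} (h : RunsIn c s T s') (hT : T ≤ T') :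
    RunsIn c s T' s' :=
  let ⟨t, ht, hr⟩ := h
  ⟨t, ht.trans hT, hr⟩

lemma RunsIn.seq {c₁ c₂ : Prog} {s s' s'' : State} {T₁ T₂ : ℕ} (h₁ : RunsIn c₁ s T₁ s')
    (h₂ : RunsIn c₂ s' T₂ s'') : RunsIn (.seq c₁ c₂) s (T₁ + T₂ + 1) s'' :=
  let ⟨_, ht₁, hr₁⟩ := h₁
  let ⟨_, ht₂, hr₂⟩ := h₂
  ⟨_, by omega, .seq hr₁ hr₂⟩

lemma RunsIn.assign (i : ℕ) (e : Expr) (s : State) :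
    RunsIn (.assign i e) s (e.cost s + 1) (s.setReg i (e.eval s)) :=
  ⟨_, le_rfl, .assign i e s⟩

lemma RunsIn.store (a e : Expr) (s : State) :
    RunsIn (.store a e) s (a.cost s + e.cost s + 1) (s.setMem (a.eval s) (e.eval s)) :=
  ⟨_, le_rfl, .store a e s⟩

/-- A loop whose body decreases the counter `k` of the invariant `Inv k`. -/
lemma RunsIn.loop {e : Expr} {c : Prog} (Inv : ℕ → State → Prop) (Te T : ℕ)
    (h : ∀ k s, Inv k s → e.cost s ≤ Te ∧
      (0 < e.eval s → ∃ k' < k, ∃ s', RunsIn c s T s' ∧ Inv k' s')) :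
    ∀ k s, Inv k s → ∃ k' s', RunsIn (.loop e c) s ((k + 1) * (Te + T + 1)) s' ∧
      Inv k' s' ∧ e.eval s' ≤ 0 := by
  intro k
  induction k using Nat.strong_induction_on with
  | _ k ih =>
    intro s hs
    obtain ⟨hc, hstep⟩ := h k s hs
    rcases lt_or_ge 0 (e.eval s) with hpos | hneg
    · obtain ⟨k', hk', s', ⟨t, ht, hr⟩, hs'⟩ := hstep hpos
      obtain ⟨k'', s'', ⟨t', ht', hr'⟩, hs'', hneg⟩ := ih k' hk' s' hs'
      refine ⟨k'', s'', ⟨_, ?_, .loop_pos hpos hr hr'⟩, hs'', hneg⟩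
      have : (k' + 1 + 1) * (Te + T + 1) ≤ (k + 1) * (Te + T + 1) :=
        Nat.mul_le_mul_right _ (by omega)
      have : (k' + 1 + 1) * (Te + T + 1) = (k' + 1) * (Te + T + 1) + (Te + T + 1) := by ring
      omega
    · refine ⟨k, s, ⟨_, ?_, .loop_nonpos hneg⟩, hs, hneg⟩
      have : 1 * (Te + T + 1) ≤ (k + 1) * (Te + T + 1) := Nat.mul_le_mul_right _ (by omega)
      omega

/-! ### Euclid's algorithm -/

/-- Euclid's algorithm on the registers `6` and `7`. -/
def euclid : Prog :=
  .loop (.reg 7) (.seq (.assign 8 (.op .mod (.reg 6) (.reg 7)))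
    (.seq (.assign 6 (.reg 7)) (.assign 7 (.reg 8))))

/-- The quotient is at least one, so the remainder is less than half of `x` and loses a bit. This
bounds the number of Euclidean steps by the bit length. -/
lemma size_mod_lt {x y : ℕ} (hy : 0 < y) (hxy : y ≤ x) : Nat.size (x % y) < Nat.size x := by
  have h1 : x % y < y := Nat.mod_lt _ hy
  have h2 : 2 * (x % y) < x := by
    have h3 := Nat.div_add_mod x y
    have h4 : 1 ≤ x / y := (Nat.one_le_div_iff hy).2 hxy
    nlinarith
  have hpos : 0 < Nat.size x := Nat.size_pos.2 (by omega)
  obtain ⟨k, hk⟩ := Nat.exists_eq_succ_of_ne_zero hpos.ne'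
  have h5 : x < 2 ^ (k + 1) := by
    have := Nat.lt_size_self x
    rwa [hk] at this
  have h6 : Nat.size (x % y) ≤ k := Nat.size_le.2 (by rw [pow_succ] at h5; omega)
  omega

lemma euclid_spec : ∃ K, ∀ (B : ℕ) (s : State) (x y : ℕ), s.Bounded B →
    s.reg 6 = x → s.reg 7 = y → ∃ s', RunsIn euclid s (K * (B + 1) ^ 2) s' ∧ s'.Bounded B ∧
      s'.reg 6 = (Nat.gcd x y : ℕ) ∧ s'.mem = s.mem ∧
      ∀ i, i < 6 ∨ 8 < i → s'.reg i = s.reg i := by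
  obtain ⟨K₀, h₀⟩ := Expr.exists_cost_le (.reg 7)
  obtain ⟨K₁, h₁⟩ := Expr.exists_cost_le (.op .mod (.reg 6) (.reg 7))
  obtain ⟨K₂, h₂⟩ := Expr.exists_cost_le (.reg 8)
  refine ⟨3 * (2 * K₀ + K₁ + K₂ + 6), fun B s x y hB hx hy => ?_⟩
  -- The counter is the total bit length, plus one if the arguments are in the wrong order: in that
  -- case the first step merely swaps them and only the flag drops.
  let Inv : ℕ → State → Prop := fun k s' => s'.Bounded B ∧ s'.mem = s.mem ∧
    (∀ i, i < 6 ∨ 8 < i → s'.reg i = s.reg i) ∧ ∃ x' y' : ℕ, s'.reg 6 = x' ∧ s'.reg 7 = y' ∧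
      Nat.gcd x' y' = Nat.gcd x y ∧ Nat.size x' + Nat.size y' + (if x' < y' then 1 else 0) = k
  obtain ⟨k', s', hrun, ⟨hb, hm, hreg, x', y', hx', hy', hg, -⟩, hneg⟩ := RunsIn.loop
    (e := .reg 7) (c := .seq (.assign 8 (.op .mod (.reg 6) (.reg 7)))
      (.seq (.assign 6 (.reg 7)) (.assign 7 (.reg 8)))) Inv (K₀ * (B + 1))
    ((K₀ + K₁ + K₂) * (B + 1) + 5) (by
      rintro k t ⟨hb, hm, hreg, x', y', hx', hy', hg, hk⟩
      refine ⟨(h₀ B t hb).2, fun hpos => ?_⟩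
      have hy0 : 0 < y' := by simpa [Expr.eval, hy'] using hpos
      have hX : x' < 2 ^ B := by simpa [hx'] using hb.1 6
      have hY : y' < 2 ^ B := by simpa [hy'] using hb.1 7
      have hlt : x' % y' < y' := Nat.mod_lt _ hy0
      let t₁ := t.setReg 8 ((x' % y' : ℕ) : ℤ)
      let t₂ := t₁.setReg 6 (y' : ℤ)
      let t₃ := t₂.setReg 7 ((x' % y' : ℕ) : ℤ)
      have b₁ : t₁.Bounded B := hb.setReg _ (by rw [Int.natAbs_natCast]; exact hlt.trans hY)
      have b₂ : t₂.Bounded B := b₁.setReg _ (by simpa using hY)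
      have b₃ : t₃.Bounded B := b₂.setReg _ (by rw [Int.natAbs_natCast]; exact hlt.trans hY)
      have r₁ := RunsIn.assign 8 (.op .mod (.reg 6) (.reg 7)) t
      have r₂ := RunsIn.assign 6 (.reg 7) t₁
      have r₃ := RunsIn.assign 7 (.reg 8) t₂
      have e₁ : (Expr.op .mod (.reg 6) (.reg 7)).eval t = ((x' % y' : ℕ) : ℤ) := by
        simp [Expr.eval, Op.apply, hx', hy']
      have e₂ : (Expr.reg 7).eval t₁ = y' := by
        simp [Expr.eval, t₁, State.setReg_reg, hy']
      have e₃ : (Expr.reg 8).eval t₂ = ((x' % y' : ℕ) : ℤ) := by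
        simp [Expr.eval, t₁, t₂, State.setReg_reg]
      rw [e₁] at r₁
      rw [e₂] at r₂
      rw [e₃] at r₃
      refine ⟨Nat.size y' + Nat.size (x' % y') + (if y' < x' % y' then 1 else 0), ?_, t₃,
        (r₁.seq (r₂.seq r₃)).mono ?_, b₃, by simp [t₁, t₂, t₃, hm], ?_, y', x' % y', ?_, ?_, ?_,
        rfl⟩
      · rw [if_neg (by omega), ← hk]
        rcases lt_or_ge x' y' with h | h
        · rw [if_pos h, Nat.mod_eq_of_lt h]; omega
        · have := size_mod_lt hy0 h
          omega
      · have c₁ := (h₁ B t hb).2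
        have c₂ := (h₀ B t₁ b₁).2
        have c₃ := (h₂ B t₂ b₂).2
        simp only [add_mul]
        omega
      · intro i hi
        rw [← hreg i hi]
        simp only [t₁, t₂, t₃, State.setReg_reg]
        rw [if_neg (by omega), if_neg (by omega), if_neg (by omega)]
      · simp [t₁, t₂, t₃, State.setReg_reg]
      · simp [t₁, t₂, t₃, State.setReg_reg]
      · rw [← hg, Nat.gcd_comm x' y', Nat.gcd_rec y' x', Nat.gcd_comm])
    _ s ⟨hB, rfl, fun _ _ => rfl, x, y, hx, hy, rfl, rfl⟩
  have hX : Nat.size x ≤ B := Nat.size_le.2 (by simpa [hx] using hB.1 6)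
  have hY : Nat.size y ≤ B := Nat.size_le.2 (by simpa [hy] using hB.1 7)
  refine ⟨s', hrun.mono ?_, hb, ?_, hm, hreg⟩
  · have hle : Nat.size x + Nat.size y + (if x < y then 1 else 0) + 1 ≤ 3 * (B + 1) := by
      split_ifs <;> omega
    refine (Nat.mul_le_mul_right _ hle).trans ?_
    have : K₀ * (B + 1) + ((K₀ + K₁ + K₂) * (B + 1) + 5) + 1 ≤
        (2 * K₀ + K₁ + K₂ + 6) * (B + 1) := by nlinarith
    refine (Nat.mul_le_mul_left _ this).trans (le_of_eq ?_)
    ring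
  · have : y' = 0 := by
      simp only [Expr.eval, hy'] at hneg
      omega
    subst this
    rw [hx', ← hg, Nat.gcd_zero_right]

/-! ### Filling an array by a recurrence -/

/-- For `q = 0, 1, …` below the content of register `4`, put `e₃` into the cell with address
`reg b + q`. The expressions can use `q` as register `5`, and `e₃` can use `gcd e₁ e₂` as
register `6`. -/
def fill (b : ℕ) (e₁ e₂ e₃ : Expr) : Prog :=
  .seq (.assign 5 (.const 0)) (.loop (.op .sub (.reg 4) (.reg 5))
    (.seq (.assign 6 e₁) (.seq (.assign 7 e₂) (.seq euclid
      (.seq (.store (.op .add (.reg b) (.reg 5)) e₃)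
        (.assign 5 (.op .add (.reg 5) (.const 1))))))))

/-- The state `s'` arises from `s` by writing `F 0, …, F (q - 1)` from address `base` on. -/
structure Filled (s : State) (base : ℕ) (F : ℕ → ℤ) (q : ℕ) (s' : State) : Prop where
  reg : ∀ i, i < 5 ∨ 8 < i → s'.reg i = s.reg i
  index : s'.reg 5 = q
  below : ∀ x < (base : ℤ), s'.mem x = s.mem x
  cells : ∀ i < q, s'.mem ((base + i : ℕ) : ℤ) = F i

lemma Filled.congr {s s' s'' : State} {base : ℕ} {F : ℕ → ℤ} {q : ℕ} (h : Filled s base F q s')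
    (hr : ∀ i, i < 6 ∨ 8 < i → s''.reg i = s'.reg i) (hm : s''.mem = s'.mem) :
    Filled s base F q s'' where
  reg i hi := by rw [hr i (by omega), h.reg i hi]
  index := by rw [hr 5 (by omega), h.index]
  below := by rw [hm]; exact h.below
  cells := by rw [hm]; exact h.cells

/-- The expressions only have to be correct in states where the cells before `q` are already
written, so `F` may be given by a recurrence on the array itself. There are at most `B` rounds, each
quadratic because of `euclid`; this gives the cube. -/
lemma fill_spec (b : ℕ) (hb : 8 < b) (e₁ e₂ e₃ : Expr) :
    ∃ K, ∀ (B : ℕ) (s : State) (base N : ℕ) (F : ℕ → ℤ),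
      s.Bounded B → s.reg b = base → s.reg 4 = N → N ≤ B → (∀ q < N, (F q).natAbs < 2 ^ B) →
      (∀ q < N, ∃ x y : ℕ, x < 2 ^ B ∧ y < 2 ^ B ∧ ∀ s', Filled s base F q s' →
        e₁.eval s' = x ∧ e₂.eval s' = y ∧ (s'.reg 6 = (Nat.gcd x y : ℕ) → e₃.eval s' = F q)) →
      ∃ s', RunsIn (fill b e₁ e₂ e₃) s (K * (B + 1) ^ 3) s' ∧ s'.Bounded B ∧
        Filled s base F N s' := by
  obtain ⟨KE, hE⟩ := euclid_spec
  obtain ⟨K₀, h₀⟩ := Expr.exists_cost_le (.op .sub (.reg 4) (.reg 5))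
  obtain ⟨K₁, h₁⟩ := Expr.exists_cost_le e₁
  obtain ⟨K₂, h₂⟩ := Expr.exists_cost_le e₂
  obtain ⟨K₃, h₃⟩ := Expr.exists_cost_le e₃
  obtain ⟨K₄, h₄⟩ := Expr.exists_cost_le (.op .add (.reg b) (.reg 5))
  obtain ⟨K₅, h₅⟩ := Expr.exists_cost_le (.op .add (.reg 5) (.const 1))
  obtain ⟨K₆, h₆⟩ := Expr.exists_cost_le (.const 0)
  refine ⟨K₀ + K₁ + K₂ + K₃ + K₄ + K₅ + KE + K₆ + 13, ?_⟩
  intro B s base N F hB hbase hN hNB hF hstep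
  have hB2 : B < 2 ^ B := Nat.lt_two_pow_self
  let Inv : ℕ → State → Prop := fun k s' => s'.Bounded B ∧ k ≤ N ∧ Filled s base F (N - k) s'
  have bs₀ : (s.setReg 5 0).Bounded B := hB.setReg _ (by simp)
  obtain ⟨k', s', hrun, ⟨hb', hk', hfill⟩, hneg⟩ := RunsIn.loop
    (e := .op .sub (.reg 4) (.reg 5))
    (c := .seq (.assign 6 e₁) (.seq (.assign 7 e₂) (.seq euclid
      (.seq (.store (.op .add (.reg b) (.reg 5)) e₃)
        (.assign 5 (.op .add (.reg 5) (.const 1))))))) Inv (K₀ * (B + 1))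
    (((K₁ + K₂ + K₃ + K₄ + K₅) * (B + 1) + KE * (B + 1) ^ 2) + 8) (by
      rintro k t ⟨tb, hk, hf⟩
      refine ⟨(h₀ B t tb).2, fun hpos => ?_⟩
      have ht4 : t.reg 4 = N := by rw [hf.reg 4 (by omega), hN]
      have ht5 : t.reg 5 = (N - k : ℕ) := hf.index
      have hk0 : 0 < k := by
        simp only [Expr.eval, Op.apply, ht4, ht5] at hpos
        omega
      obtain ⟨x, y, hx, hy, hev⟩ := hstep (N - k) (by omega)
      let t₁ := t.setReg 6 (x : ℤ)
      have b₁ : t₁.Bounded B := tb.setReg _ (by simpa using hx)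
      have f₁ : Filled s base F (N - k) t₁ := hf.congr (fun i hi => by
        simp only [t₁, State.setReg_reg]; rw [if_neg (by omega)]) rfl
      let t₂ := t₁.setReg 7 (y : ℤ)
      have b₂ : t₂.Bounded B := b₁.setReg _ (by simpa using hy)
      have f₂ : Filled s base F (N - k) t₂ := f₁.congr (fun i hi => by
        simp only [t₂, State.setReg_reg]; rw [if_neg (by omega)]) rfl
      obtain ⟨t₃, r₃, b₃, g₃, m₃, e₃'⟩ := hE B t₂ x y b₂ (by simp [t₁, t₂, State.setReg_reg])
        (by simp [t₁, t₂, State.setReg_reg])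
      have f₃ : Filled s base F (N - k) t₃ := f₂.congr e₃' m₃
      let t₄ := t₃.setMem ((base + (N - k) : ℕ) : ℤ) (F (N - k))
      have b₄ : t₄.Bounded B := b₃.setMem _ (hF _ (by omega))
      let t₅ := t₄.setReg 5 ((N - (k - 1) : ℕ) : ℤ)
      have b₅ : t₅.Bounded B := b₄.setReg _ (by simp only [Int.natAbs_natCast]; omega)
      have r₁ := RunsIn.assign 6 e₁ t
      rw [(hev t hf).1] at r₁
      have r₂ := RunsIn.assign 7 e₂ t₁
      rw [(hev t₁ f₁).2.1] at r₂
      have r₄ := RunsIn.store (.op .add (.reg b) (.reg 5)) e₃ t₃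
      rw [(hev t₃ f₃).2.2 g₃] at r₄
      have ea : (Expr.op .add (.reg b) (.reg 5)).eval t₃ = ((base + (N - k) : ℕ) : ℤ) := by
        simp only [Expr.eval, Op.apply, f₃.index, f₃.reg b (by omega), hbase]
        push_cast; ring
      rw [ea] at r₄
      have r₅ := RunsIn.assign 5 (.op .add (.reg 5) (.const 1)) t₄
      have eb : (Expr.op .add (.reg 5) (.const 1)).eval t₄ = ((N - (k - 1) : ℕ) : ℤ) := by
        simp only [Expr.eval, Op.apply, t₄, State.setMem_reg, f₃.index]
        omega
      rw [eb] at r₅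
      refine ⟨k - 1, by omega, t₅, (r₁.seq (r₂.seq (r₃.seq (r₄.seq r₅)))).mono ?_, b₅, by omega,
        ?_, ?_, ?_, ?_⟩
      · have c₁ := (h₁ B t tb).2
        have c₂ := (h₂ B t₁ b₁).2
        have c₃ := (h₃ B t₃ b₃).2
        have c₄ := (h₄ B t₃ b₃).2
        have c₅ := (h₅ B t₄ b₄).2
        simp only [add_mul]
        omega
      · intro i hi
        simp only [t₅, t₄, State.setReg_reg, State.setMem_reg]
        rw [if_neg (by omega), f₃.reg i hi]
      · simp [t₅, State.setReg_reg]
      · intro z hz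
        simp only [t₅, t₄, State.setReg_mem, State.setMem_mem]
        rw [if_neg (by omega), f₃.below z hz]
      · intro i hi
        simp only [t₅, t₄, State.setReg_mem, State.setMem_mem]
        rcases eq_or_ne i (N - k) with rfl | hne
        · simp
        · rw [if_neg (by omega), f₃.cells i (by omega)])
    N (s.setReg 5 0) ⟨bs₀, le_rfl, by
      refine ⟨fun i hi => ?_, ?_, fun _ _ => rfl, fun i hi => by omega⟩
      · simp only [State.setReg_reg]; rw [if_neg (by omega)]
      · simp [State.setReg_reg]⟩
  have hk0 : k' = 0 := by
    simp only [Expr.eval, Op.apply, hfill.index, hfill.reg 4 (by omega), hN] at hneg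
    omega
  subst hk0
  refine ⟨s', ?_, hb', by simpa using hfill⟩
  refine ((RunsIn.assign 5 (.const 0) s).seq hrun).mono ?_
  have c₆ := (h₆ B s hB).2
  have hX1 : 1 ≤ B + 1 := by omega
  have hX2 : (B + 1) ≤ (B + 1) ^ 2 := Nat.le_self_pow (by norm_num) _
  have hX3 : (B + 1) ^ 2 ≤ (B + 1) ^ 3 := Nat.pow_le_pow_right (by omega) (by norm_num)
  have hin : K₀ * (B + 1) + (((K₁ + K₂ + K₃ + K₄ + K₅) * (B + 1) + KE * (B + 1) ^ 2) + 8) + 1 ≤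
      (K₀ + K₁ + K₂ + K₃ + K₄ + K₅ + KE + 9) * (B + 1) ^ 2 := by
    have := Nat.mul_le_mul_left (K₀ + K₁ + K₂ + K₃ + K₄ + K₅) hX2
    simp only [add_mul] at *
    omega
  have hmul : (N + 1) * (K₀ * (B + 1) +
      (((K₁ + K₂ + K₃ + K₄ + K₅) * (B + 1) + KE * (B + 1) ^ 2) + 8) + 1) ≤
      (B + 1) * ((K₀ + K₁ + K₂ + K₃ + K₄ + K₅ + KE + 9) * (B + 1) ^ 2) :=
    Nat.mul_le_mul (by omega) hin
  have heq : (B + 1) * ((K₀ + K₁ + K₂ + K₃ + K₄ + K₅ + KE + 9) * (B + 1) ^ 2) =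
      (K₀ + K₁ + K₂ + K₃ + K₄ + K₅ + KE + 9) * (B + 1) ^ 3 := by ring
  have h6 : K₆ * (B + 1) ≤ K₆ * (B + 1) ^ 3 := Nat.mul_le_mul_left _ (hX2.trans hX3)
  simp only [add_mul] at *
  omega

lemma RunsIn.assign_of_eval {B K : ℕ} {s : State} {i : ℕ} {e : Expr} {x : ℕ}
    (hK : ∀ B s, State.Bounded B s →
      intCost (e.eval s) ≤ K * (B + 1) ∧ e.cost s ≤ K * (B + 1)) (hs : s.Bounded B) (hx : x ≤ B) (he : e.eval s = x) :
    RunsIn (.assign i e) s (K * (B + 1) + 1) (s.setReg i x) ∧ (s.setReg i (x : ℤ)).Bounded B := by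
  have h := RunsIn.assign i e s
  rw [he] at h
  have h2 := (hK B s hs).2
  exact ⟨h.mono (by omega),
    hs.setReg _ (by rw [Int.natAbs_natCast]; exact hx.trans_lt Nat.lt_two_pow_self)⟩

end RAM

namespace EnvyElimination

/-! ### Difference constraints and longest paths -/

/-- The Floyd-Warshall recursion for longest paths, restricted to the pairs in the relation `E`. -/
def longest (E : ℕ → ℕ → Prop) [DecidableRel E] (w : ℕ → ℕ → ℤ) : ℕ → ℕ → ℕ → ℤ
  | 0, i, j => w i j
  | k + 1, i, j =>
    if E i k ∧ E k j then
      max (longest E w k i j) (longest E w k i k + longest E w k k j)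
    else longest E w k i j

section Longest

variable {E : ℕ → ℕ → Prop} [DecidableRel E] {w : ℕ → ℕ → ℤ}

lemma longest_le_succ (k i j : ℕ) : longest E w k i j ≤ longest E w (k + 1) i j := by
  rw [longest]
  split_ifs
  · exact le_max_left _ _
  · exact le_rfl

lemma longest_mono (i j : ℕ) : Monotone fun k => longest E w k i j :=
  monotone_nat_of_le_succ fun k => longest_le_succ k i j

/-- Bounds by potential differences telescope when two paths are joined at a pivot. For `i = j` the
bound is zero, which is the necessity of the diagonal condition. -/
lemma longest_le_sub {n : ℕ} {y : ℕ → ℤ}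
    (hy : ∀ i < n, ∀ j < n, E i j → w i j ≤ y i - y j) :
    ∀ k ≤ n, ∀ i < n, ∀ j < n, E i j → longest E w k i j ≤ y i - y j := by
  intro k
  induction k with
  | zero => exact fun _ => hy
  | succ k ih =>
    intro hk i hi j hj hij
    have h1 := ih (by omega) i hi j hj hij
    rw [longest]
    split_ifs with h
    · have h2 := ih (by omega) i hi k (by omega) h.1
      have h3 := ih (by omega) k (by omega) j hj h.2
      exact max_le h1 (by linarith)
    · exact h1

/-- A path through an already processed pivot brings no further gain. In the induction, a detour
that visits the new pivot twice contains a closed walk there, which the diagonal condition makes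
nonpositive. -/
lemma longest_add_le [IsTrans ℕ E] [Std.Symm E] {n : ℕ}
    (hdiag : ∀ i < n, E i i → longest E w n i i ≤ 0) :
    ∀ t ≤ n, ∀ k < t, ∀ i j, E i k → E k j →
      longest E w t i k + longest E w t k j ≤ longest E w t i j := by
  intro t
  induction t with
  | zero => intro _ k hk; omega
  | succ t ih =>
    intro ht k hk i j hik hkj
    have ih' := ih (by omega)
    by_cases ht' : E k t
    · have hit : E i t := _root_.trans hik ht'
      have htk : E t k := symm_of E ht'
      have htj : E t j := _root_.trans htk hkj
      have htt : E t t := _root_.trans htk ht'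
      have h0 : longest E w t t t ≤ 0 :=
        (longest_mono t t (by omega : t ≤ n)).trans (hdiag t (by omega) htt)
      have e1 : longest E w (t + 1) i k =
          max (longest E w t i k) (longest E w t i t + longest E w t t k) := by
        rw [longest, if_pos ⟨hit, htk⟩]
      have e2 : longest E w (t + 1) k j =
          max (longest E w t k j) (longest E w t k t + longest E w t t j) := by
        rw [longest, if_pos ⟨ht', htj⟩]
      have e3 : longest E w (t + 1) i j =
          max (longest E w t i j) (longest E w t i t + longest E w t t j) := by
        rw [longest, if_pos ⟨hit, htj⟩]
      rw [e1, e2, e3]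
      -- For an old pivot, four combinations of the two maxima have to be compared; for the new
      -- pivot itself, `h0` shows that both maxima are attained by their first entries.
      rcases Nat.lt_succ_iff_lt_or_eq.1 hk with hlt | rfl
      · have a1 := ih' k hlt i j hik hkj
        have a2 := ih' k hlt t j htk hkj
        have a3 := ih' k hlt i t hik ht'
        have a4 := ih' k hlt t t htk ht'
        omega
      · omega
    · have hkt : k ≠ t := by
        rintro rfl
        exact ht' (_root_.trans (symm_of E hik) hik)
      have n1 : ¬ E t k := fun h => ht' (symm_of E h)
      have a1 := ih' k (by omega) i j hik hkj
      have e1 : longest E w (t + 1) i k = longest E w t i k := by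
        rw [longest, if_neg (by tauto)]
      have e2 : longest E w (t + 1) k j = longest E w t k j := by
        rw [longest, if_neg (by tauto)]
      rw [e1, e2]
      exact a1.trans (longest_le_succ t i j)

/-- A system of difference constraints is solvable iff there is no cycle of positive weight. -/
theorem exists_potential_iff [IsTrans ℕ E] [Std.Symm E] (n : ℕ) :
    (∃ y : ℕ → ℤ, ∀ i < n, ∀ j < n, E i j → w i j ≤ y i - y j) ↔
      ∀ i < n, E i i → longest E w n i i ≤ 0 := by
  constructor
  · rintro ⟨y, hy⟩ i hi hii
    simpa using longest_le_sub hy n le_rfl i hi i hi hii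
  · intro hdiag
    let s : ℕ → Finset ℕ := fun i => (Finset.range n).filter fun j => E i j
    -- The potential of `i` is the heaviest path from `i` to any vertex of its class. Vertices that
    -- are related to nobody carry no constraint and get `0`.
    refine ⟨fun i => if h : (s i).Nonempty then (s i).sup' h (longest E w n i) else 0, ?_⟩
    intro i hi j hj hij
    have hji := symm_of E hij
    have hi' : (s i).Nonempty := ⟨j, by simp [s, hj, hij]⟩
    have hj' : (s j).Nonempty := ⟨i, by simp [s, hi, hji]⟩
    simp only [dif_pos hi', dif_pos hj']
    obtain ⟨l, hl, hl'⟩ := Finset.exists_mem_eq_sup' hj' (longest E w n j)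
    rw [hl']
    simp only [s, Finset.mem_filter, Finset.mem_range] at hl
    have hil : E i l := _root_.trans hij hl.2
    have h1 : longest E w n i l ≤ (s i).sup' hi' (longest E w n i) :=
      Finset.le_sup' _ (by simp [s, hl.1, hil])
    have h2 := longest_add_le hdiag n le_rfl j hj i l hij hl.2
    have h3 : w i j ≤ longest E w n i j := longest_mono (E := E) (w := w) i j (Nat.zero_le n)
    linarith

/-- One round at most doubles the largest absolute value, whether or not there are positive cycles,
so entries gain at most one bit per round. -/
lemma abs_longest_le {n M : ℕ} (hw : ∀ i < n, ∀ j < n, |w i j| ≤ M) :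
    ∀ k ≤ n, ∀ i < n, ∀ j < n, |longest E w k i j| ≤ 2 ^ k * M := by
  intro k
  induction k with
  | zero => simpa [longest] using hw
  | succ k ih =>
    intro hk i hi j hj
    have h1 := ih (by omega) i hi j hj
    have h2 := ih (by omega) i hi k (by omega)
    have h3 := ih (by omega) k (by omega) j hj
    have h4 : (0 : ℤ) ≤ 2 ^ k * M := by positivity
    rw [longest, pow_succ]
    rw [abs_le] at *
    split_ifs
    · constructor
      · exact le_max_of_le_left (by linarith)
      · exact max_le (by linarith) (by linarith)
    · constructor <;> linarith

end Longest

/-! ### Resolving envy with unlimited supply -/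

section Extension

variable {A R : Type*} [Fintype A] [Fintype R]

/-- Two agents whose valuations of the additional items are proportional and not zero; `g` is the
greatest common divisor of the values. -/
def Proportional (v : A → R → ℕ) (g : A → ℕ) (a b : A) : Prop :=
  0 < g a ∧ 0 < g b ∧ ∀ r, v a r * g b = v b r * g a

/-- A multiple of the quadratic score `2 p r - |p|² + 2` for the normalized valuation
`p = v / ∑ v`. -/
lemma exists_strictly_proper_bundles (v : A → R → ℕ) (g : A → ℕ) (hdvd : ∀ a r, g a ∣ v a r)
    (hbez : ∀ a, ∃ z : R → ℤ, ∑ r, z r * v a r = g a) :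
    ∃ x : A → R → ℤ, (∀ a r, 0 < g a → 1 ≤ x a r) ∧ (∀ a r, g a = 0 → x a r = 0) ∧
      (∀ a b, Proportional v g a b → x a = x b) ∧
      ∀ a b, 0 < g a → ¬ Proportional v g a b → 1 ≤ ∑ r, (x a r - x b r) * v a r := by
  classical
  have hzero : ∀ a, g a = 0 → ∀ r, v a r = 0 := fun a ha r => by
    simpa [ha] using hdvd a r
  have hsum : ∀ a, 0 < g a → 0 < ∑ r, v a r := by
    intro a ha
    by_contra hs
    have hs : ∑ r, v a r = 0 := by omega
    rw [Finset.sum_eq_zero_iff] at hs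
    obtain ⟨z, hz⟩ := hbez a
    rw [Finset.sum_eq_zero (fun r hr => by rw [hs r hr]; simp)] at hz
    omega
  let S : A → ℤ := fun a => ∑ r, (v a r : ℤ)
  have hS : ∀ a, 0 < g a → 0 < S a := fun a ha => by
    have := hsum a ha
    simp only [S]
    exact_mod_cast this
  let N : A → ℤ := fun a => ∑ r, (v a r : ℤ) ^ 2
  have hNS : ∀ a, N a ≤ S a ^ 2 := fun a => by
    have h : ∑ r, v a r ^ 2 ≤ (∑ r, v a r) ^ 2 := by
      rw [pow_two, Finset.sum_mul]
      refine Finset.sum_le_sum fun r hr => ?_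
      rw [pow_two]
      exact Nat.mul_le_mul_left _ (Finset.single_le_sum (fun _ _ => Nat.zero_le _) hr)
    simp only [N, S]
    exact_mod_cast h
  -- Common denominators: the score of `a` has denominator `S a ^ 2`, and multiplying by the product
  -- `Q` of all of them makes every score integral.
  let T : A → ℤ := fun a => if g a = 0 then 1 else S a ^ 2
  have hT : ∀ a, 0 < T a := fun a => by
    simp only [T]
    split_ifs with h
    · norm_num
    · exact pow_pos (hS a (by omega)) 2
  let Q : ℤ := ∏ a, T a
  have hQ : 0 < Q := Finset.prod_pos fun a _ => hT a
  let P : A → R → ℚ := fun a r => v a r / S a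
  -- This is `Q (2 p r - |p|² + 2)` with denominators cleared. Since `|p|² ≤ 1`, the summand `2`
  -- makes all entries positive.
  let x : A → R → ℤ := fun a r =>
    if g a = 0 then 0 else Q / T a * (2 * v a r * S a - N a + 2 * S a ^ 2)
  have hxP : ∀ a, 0 < g a → ∀ r, (x a r : ℚ) = Q * (2 * P a r - ∑ r, P a r ^ 2 + 2) := by
    intro a ha r
    have hTa : T a = S a ^ 2 := by simp [T, ha.ne']
    have hdiv : T a ∣ Q := Finset.dvd_prod_of_mem T (Finset.mem_univ a)
    have hSa : (S a : ℚ) ≠ 0 := by exact_mod_cast (hS a ha).ne'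
    have hPP : ∑ r, P a r ^ 2 = (N a : ℚ) / (S a) ^ 2 := by
      simp only [P, N, div_pow]
      rw [← Finset.sum_div]
      push_cast
      rfl
    simp only [x, if_neg ha.ne']
    rw [hPP, Int.cast_mul, Int.cast_div hdiv (by exact_mod_cast (hT a).ne'), hTa]
    simp only [P]
    push_cast
    field_simp
  have hPsum : ∀ a, 0 < g a → ∑ r, P a r = 1 := by
    intro a ha
    have hSa : (S a : ℚ) ≠ 0 := by exact_mod_cast (hS a ha).ne'
    simp only [P]
    rw [← Finset.sum_div, div_eq_one_iff_eq hSa]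
    simp only [S]
    push_cast
    rfl
  have hprop : ∀ a b, 0 < g a → 0 < g b → (Proportional v g a b ↔ P a = P b) := by
    intro a b ha hb
    have hSa := hS a ha
    have hSb := hS b hb
    have hP : P a = P b ↔ ∀ r, (v a r : ℤ) * S b = v b r * S a := by
      rw [funext_iff]
      refine forall_congr' fun r => ?_
      simp only [P]
      rw [div_eq_div_iff (by exact_mod_cast hSa.ne') (by exact_mod_cast hSb.ne')]
      exact_mod_cast Iff.rfl
    rw [hP]
    constructor
    · rintro ⟨-, -, h⟩ r
      have h' : ∀ r, (v a r : ℤ) * g b = v b r * g a := fun r => by exact_mod_cast h r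
      have hs : S a * g b = S b * g a := by
        simp only [S, Finset.sum_mul]
        exact Finset.sum_congr rfl fun r _ => h' r
      have hga : (g a : ℤ) ≠ 0 := by exact_mod_cast ha.ne'
      refine mul_right_cancel₀ hga ?_
      linear_combination (-(v a r : ℤ)) * hs + S a * h' r
    · intro h
      -- Expand `g a` by Bezout: each term `v a r * S b` equals `v b r * S a`, which is divisible by
      -- `g b * S a`. Used in both directions, this yields `g a * S b = g b * S a`.
      have key : ∀ a b, (∀ r, (v a r : ℤ) * S b = v b r * S a) → (g b : ℤ) * S a ∣ g a * S b := by
        intro a b h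
        obtain ⟨z, hz⟩ := hbez a
        rw [← hz, Finset.sum_mul]
        refine Finset.dvd_sum fun r _ => ?_
        rw [mul_assoc, h r]
        exact Dvd.dvd.mul_left (mul_dvd_mul_right (by exact_mod_cast hdvd b r) _) _
      have hg : (g a : ℤ) * S b = g b * S a :=
        Int.dvd_antisymm (by positivity) (by positivity) (key b a fun r => (h r).symm) (key a b h)
      refine ⟨ha, hb, fun r => ?_⟩
      have : (v a r : ℤ) * g b = v b r * g a := by
        refine mul_right_cancel₀ hSa.ne' ?_
        linear_combination (-(v a r : ℤ)) * hg + (g a : ℤ) * h r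
      exact_mod_cast this
  refine ⟨x, ?_, fun a r ha => if_pos ha, ?_, ?_⟩
  · intro a r ha
    simp only [x, if_neg ha.ne']
    have hdiv : T a ∣ Q := Finset.dvd_prod_of_mem T (Finset.mem_univ a)
    have h1 : 0 < Q / T a := Int.ediv_pos_of_pos_of_dvd hQ (hT a).le hdiv
    have h2 := hNS a
    have h3 := hS a ha
    have h4 : 0 ≤ 2 * (v a r : ℤ) * S a := by positivity
    have h5 : 0 < S a ^ 2 := by positivity
    have h6 : 0 < Q / T a * (2 * v a r * S a - N a + 2 * S a ^ 2) := mul_pos h1 (by linarith)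
    linarith
  · intro a b hab
    have := (hprop a b hab.1 hab.2.1).1 hab
    funext r
    have e : (x a r : ℚ) = x b r := by rw [hxP a hab.1, hxP b hab.2.1, this]
    exact_mod_cast e
  · intro a b ha hab
    have hSa := hS a ha
    have hSa' : (0 : ℚ) < S a := by exact_mod_cast hSa
    have hQ' : (0 : ℚ) < Q := by exact_mod_cast hQ
    have hva : ∀ r, (v a r : ℚ) = S a * P a r := fun r => by
      simp only [P]
      field_simp
    suffices h : (0 : ℚ) < ∑ r, ((x a r : ℚ) - x b r) * v a r by
      have h' : (0 : ℤ) < ∑ r, (x a r - x b r) * v a r := by exact_mod_cast h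
      linarith
    -- Against the zero bundle the advantage is `Q * S a * (|p|² + 2)`; otherwise it is `Q * S a *
    -- |p - p'|²`, because the entries of `p` sum to one.
    rcases Nat.eq_zero_or_pos (g b) with hb | hb
    · have hxb : ∀ r, x b r = 0 := fun r => if_pos hb
      have e : ∑ r, ((x a r : ℚ) - x b r) * v a r =
          Q * S a * (∑ r, P a r ^ 2 + 2) := by
        have : ∀ r, ((x a r : ℚ) - x b r) * v a r =
            Q * S a * (2 * P a r ^ 2 + (2 - ∑ r, P a r ^ 2) * P a r) := fun r => by
          rw [hxP a ha, hxb, hva]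
          push_cast
          ring
        rw [Finset.sum_congr rfl fun r _ => this r, ← Finset.mul_sum, Finset.sum_add_distrib,
          ← Finset.mul_sum, ← Finset.mul_sum, hPsum a ha]
        ring
      rw [e]
      have : 0 ≤ ∑ r, P a r ^ 2 := Finset.sum_nonneg fun r _ => sq_nonneg _
      positivity
    · have hne : P a ≠ P b := fun h => hab ((hprop a b ha hb).2 h)
      have e : ∑ r, ((x a r : ℚ) - x b r) * v a r = Q * S a * ∑ r, (P a r - P b r) ^ 2 := by
        have : ∀ r, ((x a r : ℚ) - x b r) * v a r =
            Q * S a * ((P a r - P b r) ^ 2 + P a r ^ 2 - P b r ^ 2 +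
              (∑ r, P b r ^ 2 - ∑ r, P a r ^ 2) * P a r) := fun r => by
          rw [hxP a ha, hxP b hb, hva]
          ring
        rw [Finset.sum_congr rfl fun r _ => this r, ← Finset.mul_sum, Finset.sum_add_distrib,
          ← Finset.mul_sum, Finset.sum_sub_distrib, Finset.sum_add_distrib, hPsum a ha]
        ring
      rw [e]
      obtain ⟨r, hr⟩ := Function.ne_iff.1 hne
      have : 0 < ∑ r, (P a r - P b r) ^ 2 :=
        Finset.sum_pos' (fun r _ => sq_nonneg _)
          ⟨r, Finset.mem_univ r, by have := sub_ne_zero.2 hr; positivity⟩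
      positivity

/-- Envy can be resolved iff the agents that are indifferent to all additional items envy nobody
and, within each class of proportional agents, a system of difference constraints is solvable. -/
theorem exists_extension_iff (v : A → R → ℕ) (d : A → A → ℤ) (g : A → ℕ)
    (hdvd : ∀ a r, g a ∣ v a r) (hbez : ∀ a, ∃ z : R → ℤ, ∑ r, z r * v a r = g a) :
    (∃ ρ : A → R → ℕ, ∀ a b, d a b ≤ ∑ r, ((ρ a r : ℤ) - ρ b r) * v a r) ↔
      (∀ a b, g a = 0 → d a b ≤ 0) ∧
      ∃ y : A → ℤ, ∀ a b, Proportional v g a b → -(-d a b / g a) ≤ y a - y b := by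
  have hzero : ∀ a, g a = 0 → ∀ r, v a r = 0 := fun a ha r => by
    simpa [ha] using hdvd a r
  -- Integer division rounds down here, so the double negation is the ceiling of `d a b / g a`.
  have hceil : ∀ a b, 0 < g a → ∀ t : ℤ, -(-d a b / g a) ≤ t ↔ d a b ≤ t * g a := by
    intro a b ha t
    rw [neg_le, Int.le_ediv_iff_mul_le (by exact_mod_cast ha)]
    constructor <;> intro h <;> linarith
  constructor
  · rintro ⟨ρ, hρ⟩
    refine ⟨fun a b ha => by simpa [hzero a ha] using hρ a b, ?_⟩
    choose q hq using hdvd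
    -- The potential is the value of the agent's own added bundle in units of `g a`; proportional
    -- agents share the reduced valuation `q`.
    refine ⟨fun a => ∑ r, (ρ a r : ℤ) * q a r, ?_⟩
    rintro a b ⟨ha, hb, hab⟩
    have hqq : ∀ r, q a r = q b r := fun r => by
      have := hab r
      rw [hq a r, hq b r] at this
      have h2 : g a * g b * q a r = g a * g b * q b r := by linarith
      exact Nat.eq_of_mul_eq_mul_left (Nat.mul_pos ha hb) h2
    rw [hceil a b ha]
    refine (hρ a b).trans (le_of_eq ?_)
    rw [← Finset.sum_sub_distrib, Finset.sum_mul]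
    refine Finset.sum_congr rfl fun r _ => ?_
    rw [← hqq r, hq a r]
    push_cast
    ring
  · rintro ⟨h0, y, hy⟩
    obtain ⟨x, hx1, hx0, hxeq, hxlt⟩ := exists_strictly_proper_bundles v g hdvd hbez
    choose z hz using hbez
    -- The Bezout correction, worth exactly `y a * g a` to `a`; its entries may be negative.
    let Z : A → R → ℤ := fun a r => if g a = 0 then 0 else y a * z a r
    have hZ : ∀ a, 0 < g a → ∑ r, Z a r * v a r = y a * g a := fun a ha => by
      simp only [Z, if_neg ha.ne', mul_assoc]
      rw [← Finset.mul_sum, hz]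
    -- The first sum lets `M * x` absorb negative entries of `Z`; the second dominates the envy left
    -- after the corrections, for every pair.
    let M : ℤ := ∑ a, ∑ r, |Z a r| + ∑ a, ∑ b, |d a b - ∑ r, (Z a r - Z b r) * v a r|
    have hM1 : ∀ a r, |Z a r| ≤ M := fun a r => by
      have h1 : |Z a r| ≤ ∑ r, |Z a r| :=
        Finset.single_le_sum (f := fun r => |Z a r|) (fun _ _ => abs_nonneg _) (Finset.mem_univ r)
      have h2 : ∑ r, |Z a r| ≤ ∑ a, ∑ r, |Z a r| :=
        Finset.single_le_sum (f := fun a => ∑ r, |Z a r|)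
          (fun _ _ => Finset.sum_nonneg fun _ _ => abs_nonneg _) (Finset.mem_univ a)
      have h3 : 0 ≤ ∑ a, ∑ b, |d a b - ∑ r, (Z a r - Z b r) * v a r| :=
        Finset.sum_nonneg fun _ _ => Finset.sum_nonneg fun _ _ => abs_nonneg _
      simp only [M]
      linarith
    have hM2 : ∀ a b, |d a b - ∑ r, (Z a r - Z b r) * v a r| ≤ M := fun a b => by
      have h1 : |d a b - ∑ r, (Z a r - Z b r) * v a r| ≤
          ∑ b, |d a b - ∑ r, (Z a r - Z b r) * v a r| :=
        Finset.single_le_sum (f := fun b => |d a b - ∑ r, (Z a r - Z b r) * v a r|)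
          (fun _ _ => abs_nonneg _) (Finset.mem_univ b)
      have h2 : ∑ b, |d a b - ∑ r, (Z a r - Z b r) * v a r| ≤
          ∑ a, ∑ b, |d a b - ∑ r, (Z a r - Z b r) * v a r| :=
        Finset.single_le_sum (f := fun a => ∑ b, |d a b - ∑ r, (Z a r - Z b r) * v a r|)
          (fun _ _ => Finset.sum_nonneg fun _ _ => abs_nonneg _) (Finset.mem_univ a)
      have h3 : 0 ≤ ∑ a, ∑ r, |Z a r| :=
        Finset.sum_nonneg fun _ _ => Finset.sum_nonneg fun _ _ => abs_nonneg _
      simp only [M]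
      linarith
    have hnn : ∀ a r, 0 ≤ M * x a r + Z a r := by
      intro a r
      rcases Nat.eq_zero_or_pos (g a) with ha | ha
      · simp [hx0 a r ha, Z, ha]
      · have h1 := hM1 a r
        have h2 := hx1 a r ha
        have h3 := neg_abs_le (Z a r)
        have h4 : 0 ≤ M := (abs_nonneg _).trans h1
        nlinarith
    refine ⟨fun a r => (M * x a r + Z a r).toNat, fun a b => ?_⟩
    simp only [Int.toNat_of_nonneg (hnn _ _)]
    rcases Nat.eq_zero_or_pos (g a) with ha | ha
    · simpa [hzero a ha] using h0 a b ha
    have hsplit : ∑ r, (M * x a r + Z a r - (M * x b r + Z b r)) * v a r =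
        M * ∑ r, (x a r - x b r) * v a r + ∑ r, (Z a r - Z b r) * v a r := by
      rw [Finset.mul_sum, ← Finset.sum_add_distrib]
      exact Finset.sum_congr rfl fun r _ => by ring
    rw [hsplit]
    -- Within a class the `x` parts cancel and the constraint on `y` decides; across classes the
    -- strict gain of at least one is multiplied by `M`.
    by_cases hab : Proportional v g a b
    · have hb := hab.2.1
      rw [hxeq a b hab]
      simp only [sub_self, zero_mul, Finset.sum_const_zero, mul_zero, zero_add]
      have h1 := (hceil a b ha _).1 (hy a b hab)
      refine h1.trans (le_of_eq ?_)
      have h2 : ∑ r, Z b r * v a r = y b * g a := by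
        have hgb : (g b : ℤ) ≠ 0 := by exact_mod_cast hb.ne'
        refine mul_right_cancel₀ hgb ?_
        have h3 := hZ b hb
        have h4 : (∑ r, Z b r * v a r) * g b = (∑ r, Z b r * v b r) * g a := by
          rw [Finset.sum_mul, Finset.sum_mul]
          refine Finset.sum_congr rfl fun r _ => ?_
          have := hab.2.2 r
          zify at this
          linear_combination Z b r * this
        rw [h4, h3]
        ring
      simp only [sub_mul]
      rw [Finset.sum_sub_distrib, hZ a ha, h2]
    · have h1 := hxlt a b ha hab
      have h2 := le_abs_self (d a b - ∑ r, (Z a r - Z b r) * v a r)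
      have h3 := hM2 a b
      have h4 : 0 ≤ M := (abs_nonneg _).trans h3
      nlinarith

end Extension

end EnvyElimination

namespace RAM

/-! ### Arithmetic expressions and branch-free tests -/

instance : Add Expr := ⟨.op .add⟩
instance : Sub Expr := ⟨.op .sub⟩
instance : Mul Expr := ⟨.op .mul⟩
instance : Div Expr := ⟨.op .div⟩
instance : Mod Expr := ⟨.op .mod⟩

namespace Expr

/-- `1` if the value of `e` is positive and `0` otherwise. -/
def pos (e : Expr) : Expr := .const 0 - (.const 0 - e) / (e * e + .const 1)

variable (s : State) (e f : Expr)

lemma eval_const (c : ℤ) : (Expr.const c).eval s = c := rfl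
lemma eval_reg (i : ℕ) : (Expr.reg i).eval s = s.reg i := rfl
lemma eval_mem : (Expr.mem e).eval s = s.mem (e.eval s) := rfl
lemma eval_add : (e + f).eval s = e.eval s + f.eval s := rfl
lemma eval_sub : (e - f).eval s = e.eval s - f.eval s := rfl
lemma eval_mul : (e * f).eval s = e.eval s * f.eval s := rfl
lemma eval_div : (e / f).eval s = e.eval s / f.eval s := rfl
lemma eval_mod : (e % f).eval s = e.eval s % f.eval s := rfl

/-- Since `|x| < x² + 1`, the floor of `-x / (x² + 1)` is `-1` for positive `x` and `0` otherwise.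
Tests can thus be used as factors inside expressions. -/
lemma eval_pos : (pos e).eval s = if 0 < e.eval s then 1 else 0 := by
  simp only [pos, eval_sub, eval_div, eval_add, eval_mul, eval_const]
  generalize e.eval s = x
  split_ifs with h
  · have : (0 - x) / (x * x + 1) = -1 := by
      rw [Int.ediv_eq_iff_of_pos (by positivity)]
      constructor <;> nlinarith
    rw [this]; norm_num
  · have : (0 - x) / (x * x + 1) = 0 := by
      apply Int.ediv_eq_zero_of_lt <;> nlinarith
    rw [this]; norm_num

end Expr

end RAM

namespace EnvyElimination.Inst

open RAM

variable (I : Inst)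

/-! ### The computed quantities and their memory layout -/

/-- The value of an initial item, with natural numbers as indices. -/
def valP (a j : ℕ) : ℕ := if h : a < I.n ∧ j < I.p then I.v ⟨a, h.1⟩ (.inl ⟨j, h.2⟩) else 0

/-- The value of an additional item, with natural numbers as indices. -/
def valR (a r : ℕ) : ℕ := if h : a < I.n ∧ r < I.m then I.v ⟨a, h.1⟩ (.inr ⟨r, h.2⟩) else 0

/-- The incidence matrix of the initial bundles, with natural numbers as indices. -/
def holds (a j : ℕ) : ℕ :=
  if h : a < I.n ∧ j < I.p then (if ⟨j, h.2⟩ ∈ I.σ ⟨a, h.1⟩ then 1 else 0) else 0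

/-- The greatest common divisor of the values of the first `r` additional items. -/
def prefixGcd (a : ℕ) : ℕ → ℕ
  | 0 => 0
  | r + 1 => Nat.gcd (prefixGcd a r) (I.valR a r)

/-- The greatest common divisor of the values of all additional items. -/
def gcdR (a : ℕ) : ℕ := I.prefixGcd a I.m

/-- The envy of `a` towards `b` that is due to the first `j` initial items. -/
def prefixEnvy (a b j : ℕ) : ℤ :=
  ∑ i ∈ Finset.range j, (I.valP a i : ℤ) * (I.holds b i - I.holds a i)

/-- The initial envy of `a` towards `b`. -/
def envy (a b : ℕ) : ℤ := I.prefixEnvy a b I.p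

/-- A measure for how far the valuations of the first `r` additional items are from being
proportional. -/
def prefixMismatch (a b r : ℕ) : ℤ :=
  ∑ i ∈ Finset.range r, ((I.valR a i : ℤ) * I.gcdR b - I.valR b i * I.gcdR a) ^ 2

/-- Proportional, nonzero valuations of the additional items. -/
def Rel (a b : ℕ) : Prop := 0 < I.gcdR a ∧ 0 < I.gcdR b ∧ I.prefixMismatch a b I.m ≤ 0

instance : DecidableRel I.Rel := fun a b => by unfold Rel; infer_instance

/-- The lower bound on the difference of the scaled values of `a` and `b`. -/
def weight (a b : ℕ) : ℤ := -(-I.envy a b / I.gcdR a)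

/-- The violations of the criterion that the pair `a, b` accounts for. -/
def violation (a b : ℕ) : ℤ :=
  (if I.gcdR a = 0 ∧ 0 < I.envy a b then 1 else 0) +
    (if I.Rel a a ∧ 0 < longest I.Rel I.weight I.n a a then 1 else 0)

/-- The lengths of the arrays in the memory: the valuations of the initial and of the additional
items, the incidence matrix, the rest of the input, and six computed arrays. -/
def len : ℕ → ℕ
  | 0 => I.n * I.p
  | 1 => I.n * I.m
  | 2 => I.n * I.p
  | 3 => I.n + I.p + I.m
  | 4 => I.n * (I.m + 1)
  | 5 => I.n * I.n * (I.p + 1)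
  | 6 => I.n * I.n * (I.m + 1)
  | 7 => I.n * I.n
  | 8 => (I.n + 1) * (I.n * I.n)
  | 9 => I.n * I.n + 1
  | _ => 0

/-- The address of the first cell of an array. -/
def base : ℕ → ℕ
  | 0 => 4 + I.m
  | k + 1 => base k + I.len k

/-- The contents of the arrays. -/
noncomputable def content : ℕ → ℕ → ℤ
  | 4, q => I.prefixGcd (q / (I.m + 1)) (q % (I.m + 1))
  | 5, q => I.prefixEnvy (q / (I.p + 1) / I.n) (q / (I.p + 1) % I.n) (q % (I.p + 1))
  | 6, q => I.prefixMismatch (q / (I.m + 1) / I.n) (q / (I.m + 1) % I.n) (q % (I.m + 1))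
  | 7, q => if I.Rel (q / I.n) (q % I.n) then 1 else 0
  | 8, q => longest I.Rel I.weight (q / (I.n * I.n)) (q / I.n % I.n) (q % I.n)
  | 9, q => ∑ i ∈ Finset.range q, I.violation (i / I.n) (i % I.n)
  | j, q => (I.encode.getD (I.base j + q) 0 : ℕ)

/-- The arrays before the array `k` are complete. -/
structure Good (k : ℕ) (s : State) : Prop where
  reg_n : s.reg 1 = I.n
  reg_p : s.reg 2 = I.p
  reg_m : s.reg 3 = I.m
  reg_base : ∀ j ≤ k, s.reg (10 + j) = I.base j
  mem_eq : ∀ j < k, ∀ i < I.len j, s.mem ((I.base j + i : ℕ) : ℤ) = I.content j i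

/-- The arrays before the array `k` are complete, as well as the first `q` cells of this array. -/
structure View (k q : ℕ) (s : State) : Prop extends Good I k s where
  index : s.reg 5 = q
  mem_self : ∀ i < q, s.mem ((I.base k + i : ℕ) : ℤ) = I.content k i

/-- The cell of the array `j` at the position `e`. -/
def cell (j : ℕ) (e : Expr) : Expr := .mem (.reg (10 + j) + e)

variable {I}

lemma Good.eval_cell {k : ℕ} {s : State} (h : Good I k s) {j : ℕ} (hj : j < k) {e : Expr}
    {i : ℕ} (hi : i < I.len j) (he : e.eval s = (i : ℕ)) :
    (cell j e).eval s = I.content j i := by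
  rw [cell, Expr.eval_mem, Expr.eval_add, Expr.eval_reg, h.reg_base j hj.le, he,
    ← h.mem_eq j hj i hi]
  push_cast
  rfl

lemma View.eval_cell_self {k q : ℕ} {s : State} (h : View I k q s) {e : Expr}
    {i : ℕ} (hi : i < q) (he : e.eval s = (i : ℕ)) :
    (cell k e).eval s = I.content k i := by
  rw [cell, Expr.eval_mem, Expr.eval_add, Expr.eval_reg, h.reg_base k le_rfl, he,
    ← h.mem_self i hi]
  push_cast
  rfl

variable (I)

/-- A bound for the bit lengths of all numbers that occur. -/
noncomputable def bits : ℕ := 7 * (inputSize I.encode + 1) ^ 3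

variable {I}

lemma base_mono : Monotone I.base := monotone_nat_of_le_succ fun k => by
  rw [base]; exact Nat.le_add_right _ _

/-! ### One phase per array -/

/-- Compute the array `k`. -/
def phase (k : ℕ) (l e₁ e₂ e₃ : Expr) : Prog :=
  .seq (.assign 4 l) (.seq (fill (10 + k) e₁ e₂ e₃)
    (.assign (10 + (k + 1)) (.reg (10 + k) + .reg 4)))

/-- Translates `fill_spec` to the memory layout. The hypotheses are uniform in the instance, so `K`
depends on the expressions alone. -/
lemma phase_spec (k : ℕ) (l e₁ e₂ e₃ : Expr)
    (hl : ∀ I s, Good I k s → l.eval s = I.len k)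
    (hlen : ∀ I : Inst, I.len k ≤ I.bits) (hbase : ∀ I : Inst, I.base (k + 1) ≤ I.bits)
    (hcontent : ∀ I : Inst, ∀ q < I.len k, (I.content k q).natAbs < 2 ^ I.bits)
    (heval : ∀ I : Inst, ∀ q < I.len k, ∃ x y : ℕ, x < 2 ^ I.bits ∧ y < 2 ^ I.bits ∧
      ∀ s, View I k q s → e₁.eval s = x ∧ e₂.eval s = y ∧
        (s.reg 6 = (Nat.gcd x y : ℕ) → e₃.eval s = I.content k q)) :
    ∃ K, ∀ I s, s.Bounded I.bits → Good I k s →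
      ∃ s', RunsIn (phase k l e₁ e₂ e₃) s (K * (I.bits + 1) ^ 3) s' ∧ s'.Bounded I.bits ∧
        Good I (k + 1) s' := by
  obtain ⟨K₀, h₀⟩ := Expr.exists_cost_le l
  obtain ⟨K₁, h₁⟩ := fill_spec (10 + k) (by omega) e₁ e₂ e₃
  obtain ⟨K₂, h₂⟩ := Expr.exists_cost_le (.reg (10 + k) + .reg 4)
  refine ⟨K₀ + K₁ + K₂ + 4, fun I s hs hg => ?_⟩
  have hB : I.bits < 2 ^ I.bits := Nat.lt_two_pow_self
  let s₁ := s.setReg 4 (I.len k)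
  have b₁ : s₁.Bounded I.bits := hs.setReg _ (by
    rw [Int.natAbs_natCast]; exact (hlen I).trans_lt hB)
  have r₁ := RunsIn.assign 4 l s
  rw [hl I s hg] at r₁
  have sr : ∀ i, i ≠ 4 → s₁.reg i = s.reg i := fun i hi => by
    simp only [s₁, State.setReg_reg, if_neg hi]
  have hcells : ∀ s' q, Filled s₁ (I.base k) (I.content k) q s' → View I k q s' := by
    intro s' q hf
    have rr : ∀ i, i < 4 ∨ 8 < i → s'.reg i = s.reg i := fun i hi => by
      rw [hf.reg i (by omega), sr i (by omega)]
    refine ⟨⟨?_, ?_, ?_, ?_, ?_⟩, hf.index, hf.cells⟩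
    · rw [rr 1 (by omega), hg.reg_n]
    · rw [rr 2 (by omega), hg.reg_p]
    · rw [rr 3 (by omega), hg.reg_m]
    · intro j hj
      rw [rr _ (by omega), hg.reg_base j hj]
    · intro j hj i hi
      -- Earlier arrays lie entirely below `base k`, where filling changes nothing.
      have hlt : I.base j + i < I.base k := by
        have : I.base (j + 1) ≤ I.base k := base_mono hj
        rw [base] at this
        omega
      rw [hf.below _ (by exact_mod_cast hlt)]
      exact hg.mem_eq j hj i hi
  obtain ⟨s₂, r₂, b₂, f₂⟩ := h₁ I.bits s₁ (I.base k) (I.len k) (I.content k) b₁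
    (by rw [sr _ (by omega), hg.reg_base k le_rfl]) (by simp [s₁, State.setReg_reg]) (hlen I)
    (hcontent I) (fun q hq => by
      obtain ⟨x, y, hx, hy, h⟩ := heval I q hq
      exact ⟨x, y, hx, hy, fun s' hf => h s' (hcells s' q hf)⟩)
  have v₂ := hcells s₂ _ f₂
  have r₃ := RunsIn.assign (10 + (k + 1)) (.reg (10 + k) + .reg 4) s₂
  have e₃ : (Expr.reg (10 + k) + Expr.reg 4).eval s₂ = I.base (k + 1) := by
    rw [Expr.eval_add, Expr.eval_reg, Expr.eval_reg, v₂.reg_base k le_rfl, f₂.reg 4 (by omega),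
      base]
    simp [s₁, State.setReg_reg]
  rw [e₃] at r₃
  refine ⟨_, (r₁.seq (r₂.seq r₃)).mono ?_, b₂.setReg _ (by
    rw [Int.natAbs_natCast]; exact (hbase I).trans_lt hB), ⟨?_, ?_, ?_, ?_, ?_⟩⟩
  · have c₀ := (h₀ I.bits s hs).2
    have c₂ := (h₂ I.bits s₂ b₂).2
    have hX : I.bits + 1 ≤ (I.bits + 1) ^ 3 := Nat.le_self_pow (by norm_num) _
    have m₀ := Nat.mul_le_mul_left K₀ hX
    have m₂ := Nat.mul_le_mul_left K₂ hX
    simp only [add_mul]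
    omega
  · rw [State.setReg_reg, if_neg (by omega), v₂.reg_n]
  · rw [State.setReg_reg, if_neg (by omega), v₂.reg_p]
  · rw [State.setReg_reg, if_neg (by omega), v₂.reg_m]
  · intro j hj
    rw [State.setReg_reg]
    split_ifs with h
    · rw [show j = k + 1 by omega]
    · exact v₂.reg_base j (by omega)
  · intro j hj i hi
    rw [State.setReg_mem]
    rcases Nat.lt_succ_iff_lt_or_eq.1 hj with h | rfl
    · exact v₂.mem_eq j h i hi
    · exact v₂.mem_self i hi

/-! ### The input -/

lemma getD_rowMajor {a b : ℕ} (M : Fin a → Fin b → ℕ) {i j : ℕ} (hi : i < a) (hj : j < b) :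
    (rowMajor M).getD (i * b + j) 0 = M ⟨i, hi⟩ ⟨j, hj⟩ := by
  have hlt : i * b + j < a * b := by
    calc i * b + j < (i + 1) * b := by rw [add_mul]; omega
      _ ≤ a * b := Nat.mul_le_mul_right _ hi
  have h1 : (i * b + j) / b = i := by
    rw [mul_comm, Nat.mul_add_div (by omega), Nat.div_eq_of_lt hj, add_zero]
  have h2 : (i * b + j) % b = j := by
    rw [mul_comm, Nat.mul_add_mod, Nat.mod_eq_of_lt hj]
  rw [rowMajor, List.getD_eq_getElem _ _ (by simpa using hlt), List.getElem_ofFn]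
  congr 1
  · simp [Fin.divNat, h1]
  · simp [Fin.modNat, h2]

@[simp] lemma length_rowMajor {a b : ℕ} (M : Fin a → Fin b → ℕ) :
    (rowMajor M).length = a * b := by
  simp [rowMajor]

/-- The header and the supplies fill the `4 + m` cells before array 0, and the input ends with array
3. Hence the first computed array starts right after the input. -/
lemma length_encode : I.encode.length = I.base 4 := by
  simp [encode, base, len]
  ring

lemma add_lt_mul {a b i j : ℕ} (hi : i < a) (hj : j < b) : i * b + j < a * b := by
  calc i * b + j < (i + 1) * b := by rw [add_mul]; omega
    _ ≤ a * b := Nat.mul_le_mul_right _ hi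

lemma content_zero {a j : ℕ} (ha : a < I.n) (hj : j < I.p) :
    I.content 0 (a * I.p + j) = I.valP a j := by
  have hlt := add_lt_mul ha hj
  simp only [content, encode, base, valP]
  rw [dif_pos ⟨ha, hj⟩, ← getD_rowMajor (fun a j => I.v a (.inl j)) ha hj]
  congr 1
  rw [List.getD_append _ _ _ _ (by simp; omega), List.getD_append _ _ _ _ (by simp; omega),
    List.getD_append _ _ _ _ (by simp; omega), List.getD_append _ _ _ _ (by simp; omega),
    List.getD_append _ _ _ _ (by simp; omega), List.getD_append_right _ _ _ _ (by simp; omega)]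
  congr 1
  simp; omega

lemma content_one {a r : ℕ} (ha : a < I.n) (hr : r < I.m) :
    I.content 1 (a * I.m + r) = I.valR a r := by
  have hlt := add_lt_mul ha hr
  simp only [content, encode, base, valR, len]
  rw [dif_pos ⟨ha, hr⟩, ← getD_rowMajor (fun a j => I.v a (.inr j)) ha hr]
  congr 1
  rw [List.getD_append _ _ _ _ (by simp; omega), List.getD_append _ _ _ _ (by simp; omega),
    List.getD_append _ _ _ _ (by simp; omega), List.getD_append _ _ _ _ (by simp; omega),
    List.getD_append_right _ _ _ _ (by simp; omega)]
  congr 1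
  simp; omega

lemma content_two {a j : ℕ} (ha : a < I.n) (hj : j < I.p) :
    I.content 2 (a * I.p + j) = I.holds a j := by
  have hlt := add_lt_mul ha hj
  simp only [content, encode, base, holds, len]
  rw [dif_pos ⟨ha, hj⟩, ← getD_rowMajor (fun a j => if j ∈ I.σ a then 1 else 0) ha hj]
  congr 1
  rw [List.getD_append _ _ _ _ (by simp; omega), List.getD_append _ _ _ _ (by simp; omega),
    List.getD_append _ _ _ _ (by simp; omega),
    List.getD_append_right _ _ _ _ (by simp; omega)]
  congr 1
  simp; omega

lemma size_le_inputSize {x : List ℕ} {a : ℕ} (ha : a ∈ x) : Nat.size a ≤ inputSize x := by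
  have : Nat.size a + 1 ≤ inputSize x :=
    List.single_le_sum (fun _ _ => Nat.zero_le _) _ (List.mem_map.2 ⟨a, ha, rfl⟩)
  omega

lemma getD_lt (x : List ℕ) (i : ℕ) : x.getD i 0 < 2 ^ inputSize x := by
  rcases lt_or_ge i x.length with h | h
  · rw [List.getD_eq_getElem _ _ h]
    exact Nat.size_le.1 (size_le_inputSize (List.getElem_mem h))
  · rw [List.getD_eq_default _ _ h]
    positivity

lemma length_le_inputSize (x : List ℕ) : x.length ≤ inputSize x := by
  induction x with
  | nil => simp
  | cons a x ih =>
    simp only [inputSize, List.length_cons, List.map_cons, List.sum_cons] at *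
    omega

end EnvyElimination.Inst

namespace EnvyElimination.Inst

open RAM

variable {I : Inst}

/-! ### Bounds -/

lemma base_four_le : I.base 4 ≤ inputSize I.encode :=
  length_encode (I := I) ▸ length_le_inputSize I.encode

/-- Array 3 lists all names explicitly, so the numbers of agents and items themselves, not just
their bit lengths, are bounded by the input size. -/
lemma n_le : I.n ≤ inputSize I.encode := by
  have := base_four_le (I := I)
  simp only [base, len] at this
  omega

lemma p_le : I.p ≤ inputSize I.encode := by
  have := base_four_le (I := I)
  simp only [base, len] at this
  omega

lemma m_le : I.m ≤ inputSize I.encode := by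
  have := base_four_le (I := I)
  simp only [base, len] at this
  omega

/-- A computed array is indexed by at most three coordinates, each with at most `inputSize + 1`
values. -/
lemma len_le {k : ℕ} (hk : 4 ≤ k) : I.len k ≤ (inputSize I.encode + 1) ^ 3 := by
  have hn := n_le (I := I)
  have hp := p_le (I := I)
  have hm := m_le (I := I)
  generalize inputSize I.encode = s at *
  have hn' : I.n ≤ s + 1 := by omega
  have h3 : (s + 1) ^ 3 = (s + 1) * (s + 1) * (s + 1) := by ring
  have key : ∀ a b c : ℕ, a ≤ s + 1 → b ≤ s + 1 → c ≤ s + 1 → a * b * c ≤ (s + 1) ^ 3 :=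
    fun a b c ha hb hc => h3 ▸ Nat.mul_le_mul (Nat.mul_le_mul ha hb) hc
  unfold len
  split
  · omega
  · omega
  · omega
  · omega
  · simpa using key 1 I.n (I.m + 1) (by omega) hn' (by omega)
  · exact key _ _ _ hn' hn' (by omega)
  · exact key _ _ _ hn' hn' (by omega)
  · simpa using key I.n I.n 1 hn' hn' (by omega)
  · simpa [mul_assoc] using key (I.n + 1) I.n I.n (by omega) hn' hn'
  · have : I.n * I.n ≤ s * s := Nat.mul_le_mul hn hn
    nlinarith [key 1 1 1 (by omega) (by omega) (by omega)]
  · exact Nat.zero_le _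

lemma len_le_bits {k : ℕ} (hk : 4 ≤ k) : I.len k ≤ I.bits :=
  (len_le hk).trans (by rw [bits]; omega)

/-- The factor `7` in `bits` accounts for the input and the six computed arrays. -/
lemma base_succ_le {k : ℕ} (hk : k ≤ 9) : I.base (k + 1) ≤ I.bits := by
  have h : I.base (k + 1) ≤ I.base 10 := base_mono (by omega)
  have h4 := base_four_le (I := I)
  have e : I.base 10 = I.base 4 + I.len 4 + I.len 5 + I.len 6 + I.len 7 + I.len 8 + I.len 9 := rfl
  have l4 := len_le (I := I) (k := 4) (by omega)
  have l5 := len_le (I := I) (k := 5) (by omega)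
  have l6 := len_le (I := I) (k := 6) (by omega)
  have l7 := len_le (I := I) (k := 7) (by omega)
  have l8 := len_le (I := I) (k := 8) (by omega)
  have l9 := len_le (I := I) (k := 9) (by omega)
  have : inputSize I.encode + 1 ≤ (inputSize I.encode + 1) ^ 3 :=
    Nat.le_self_pow (by norm_num) _
  rw [bits]
  omega

lemma valP_lt (a j : ℕ) : I.valP a j < 2 ^ inputSize I.encode := by
  by_cases h : a < I.n ∧ j < I.p
  · have := content_zero h.1 h.2
    simp only [content] at this
    have h2 := getD_lt I.encode (I.base 0 + (a * I.p + j))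
    omega
  · rw [valP, dif_neg h]; positivity

lemma valR_lt (a r : ℕ) : I.valR a r < 2 ^ inputSize I.encode := by
  by_cases h : a < I.n ∧ r < I.m
  · have := content_one h.1 h.2
    simp only [content] at this
    have h2 := getD_lt I.encode (I.base 1 + (a * I.m + r))
    omega
  · rw [valR, dif_neg h]; positivity

lemma holds_le (a j : ℕ) : I.holds a j ≤ 1 := by
  rw [holds]
  split_ifs <;> simp

lemma prefixGcd_lt (a r : ℕ) : I.prefixGcd a r < 2 ^ inputSize I.encode := by
  induction r with
  | zero => rw [prefixGcd]; positivity
  | succ r ih =>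
    rw [prefixGcd]
    rcases Nat.eq_zero_or_pos (I.valR a r) with h | h
    · rwa [h, Nat.gcd_zero_right]
    · exact (Nat.gcd_le_right _ h).trans_lt (valR_lt a r)

lemma natAbs_lt_of_abs_le {x : ℤ} {e B : ℕ} (h : |x| ≤ 2 ^ e) (he : e < B) :
    x.natAbs < 2 ^ B := by
  have h1 : x.natAbs ≤ 2 ^ e := by
    rw [Int.abs_eq_natAbs] at h
    exact_mod_cast h
  exact h1.trans_lt (Nat.pow_lt_pow_right (by norm_num) he)

lemma lt_bits : 7 * inputSize I.encode + 6 < I.bits := by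
  have : inputSize I.encode + 1 ≤ (inputSize I.encode + 1) ^ 3 :=
    Nat.le_self_pow (by norm_num) _
  rw [bits]
  omega

lemma natCast_le_two_pow {a s : ℕ} (h : a ≤ s) : (a : ℤ) ≤ 2 ^ s := by
  have : a < 2 ^ s := h.trans_lt Nat.lt_two_pow_self
  exact_mod_cast this.le

lemma abs_prefixEnvy_le (a b j : ℕ) (hj : j ≤ I.p) :
    |I.prefixEnvy a b j| ≤ 2 ^ (2 * inputSize I.encode) := by
  have h1 : |I.prefixEnvy a b j| ≤ ∑ i ∈ Finset.range j, (2 : ℤ) ^ inputSize I.encode := by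
    refine (Finset.abs_sum_le_sum_abs _ _).trans (Finset.sum_le_sum fun i _ => ?_)
    have h2 : (I.valP a i : ℤ) ≤ 2 ^ inputSize I.encode := by exact_mod_cast (valP_lt a i).le
    have h3 := holds_le (I := I) a i
    have h4 := holds_le (I := I) b i
    have h5 : |(I.holds b i : ℤ) - I.holds a i| ≤ 1 := by rw [abs_le]; omega
    rw [abs_mul, abs_of_nonneg (by positivity : (0 : ℤ) ≤ I.valP a i)]
    calc _ ≤ (2 : ℤ) ^ inputSize I.encode * 1 := by gcongr
      _ = _ := mul_one _
  refine h1.trans ?_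
  rw [Finset.sum_const, Finset.card_range, nsmul_eq_mul, two_mul, pow_add]
  gcongr
  exact natCast_le_two_pow (hj.trans p_le)

lemma abs_prefixMismatch_le (a b r : ℕ) (hr : r ≤ I.m) :
    |I.prefixMismatch a b r| ≤ 2 ^ (5 * inputSize I.encode) := by
  have hv : ∀ a i, (I.valR a i : ℤ) ≤ 2 ^ inputSize I.encode := fun a i => by
    exact_mod_cast (valR_lt a i).le
  have hg : ∀ a, (I.gcdR a : ℤ) ≤ 2 ^ inputSize I.encode := fun a => by
    exact_mod_cast (prefixGcd_lt a I.m).le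
  have hm : (r : ℤ) ≤ 2 ^ inputSize I.encode := natCast_le_two_pow (hr.trans m_le)
  generalize inputSize I.encode = s at *
  have h1 : |I.prefixMismatch a b r| ≤ ∑ i ∈ Finset.range r, (2 : ℤ) ^ (4 * s) := by
    refine (Finset.abs_sum_le_sum_abs _ _).trans (Finset.sum_le_sum fun i _ => ?_)
    have hp : ∀ a b, (I.valR a i : ℤ) * I.gcdR b ≤ 2 ^ (2 * s) := fun a b => by
      rw [two_mul, pow_add]
      exact mul_le_mul (hv _ _) (hg _) (Int.natCast_nonneg _) (pow_nonneg (by norm_num) _)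
    have h5 : |(I.valR a i : ℤ) * I.gcdR b - I.valR b i * I.gcdR a| ≤ 2 ^ (2 * s) := by
      have h6 := hp a b
      have h7 := hp b a
      have h8 : (0 : ℤ) ≤ I.valR a i * I.gcdR b := by positivity
      have h9 : (0 : ℤ) ≤ I.valR b i * I.gcdR a := by positivity
      rw [abs_le]
      constructor <;> linarith
    rw [abs_pow, show 4 * s = (2 * s) * 2 by ring, pow_mul]
    exact pow_le_pow_left₀ (abs_nonneg _) h5 2
  refine h1.trans ?_
  rw [Finset.sum_const, Finset.card_range, nsmul_eq_mul, show 5 * s = s + 4 * s by ring, pow_add]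
  exact mul_le_mul_of_nonneg_right hm (pow_nonneg (by norm_num) _)

/-- Integer division does not increase the absolute value; for gcd zero the quotient is zero by
convention. -/
lemma abs_weight_le (a b : ℕ) : |I.weight a b| ≤ (2 ^ (2 * inputSize I.encode) : ℕ) := by
  have h : |I.envy a b| ≤ _ := abs_prefixEnvy_le a b I.p le_rfl
  have h2 := Int.natAbs_ediv_le_natAbs (-I.envy a b) (I.gcdR a)
  rw [Int.natAbs_neg] at h2
  rw [weight, abs_neg, Nat.cast_pow, Nat.cast_ofNat]
  refine le_trans ?_ h
  rw [Int.abs_eq_natAbs, Int.abs_eq_natAbs]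
  exact_mod_cast h2

lemma content_natAbs_lt {k : ℕ} (hk : 4 ≤ k) (hk' : k ≤ 9) :
    ∀ q < I.len k, (I.content k q).natAbs < 2 ^ I.bits := by
  intro q hq
  have hb := lt_bits (I := I)
  have hmod : ∀ w, q % (w + 1) ≤ w := fun w => Nat.lt_succ_iff.1 (Nat.mod_lt _ (by omega))
  obtain rfl | rfl | rfl | rfl | rfl | rfl :
    k = 4 ∨ k = 5 ∨ k = 6 ∨ k = 7 ∨ k = 8 ∨ k = 9 := by omega
  · simp only [content, Int.natAbs_natCast]
    exact (prefixGcd_lt _ _).trans (Nat.pow_lt_pow_right (by norm_num) (by omega))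
  · exact natAbs_lt_of_abs_le (abs_prefixEnvy_le _ _ _ (hmod _)) (by omega)
  · exact natAbs_lt_of_abs_le (abs_prefixMismatch_le _ _ _ (hmod _)) (by omega)
  · refine natAbs_lt_of_abs_le (e := 0) ?_ (by omega)
    simp only [content]
    split_ifs <;> simp
  · have hn : 0 < I.n := by
      rcases Nat.eq_zero_or_pos I.n with h | h
      · simp [len, h] at hq
      · exact h
    have hk : q / (I.n * I.n) ≤ I.n := by
      rw [← Nat.lt_succ_iff]
      exact Nat.div_lt_of_lt_mul (by rw [mul_comm]; exact hq)
    have h := abs_longest_le (E := I.Rel) (w := I.weight) (n := I.n)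
      (M := 2 ^ (2 * inputSize I.encode)) (fun i _ j _ => abs_weight_le i j)
      (q / (I.n * I.n)) hk (q / I.n % I.n) (Nat.mod_lt _ hn) (q % I.n) (Nat.mod_lt _ hn)
    -- The exponent becomes the layer index plus twice the input size, hence at most three times the
    -- input size.
    rw [Nat.cast_pow, Nat.cast_ofNat, ← pow_add] at h
    refine natAbs_lt_of_abs_le h ?_
    have := n_le (I := I)
    omega
  · have h : |I.content 9 q| ≤ ∑ i ∈ Finset.range q, (2 : ℤ) := by
      refine (Finset.abs_sum_le_sum_abs _ _).trans (Finset.sum_le_sum fun i _ => ?_)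
      rw [violation]
      split_ifs <;> simp
    rw [Finset.sum_const, Finset.card_range, nsmul_eq_mul] at h
    have hq' : q ≤ (inputSize I.encode + 1) ^ 3 := hq.le.trans (len_le (by omega))
    -- The crude estimate `2 * q ≤ 2 ^ (2 * q)` is enough, since `q` is at most `(inputSize + 1) ^
    -- 3`.
    refine natAbs_lt_of_abs_le (e := 2 * q) (h.trans ?_) (by rw [bits]; have := Nat.one_le_pow 3 (inputSize I.encode + 1) (by omega); omega)
    have := natCast_le_two_pow (le_refl (2 * q))
    push_cast at this
    linarith

/-! ### The program -/

/-- The number of agents. -/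
def rn : Expr := .reg 1

/-- The number of initial items. -/
def rp : Expr := .reg 2

/-- The number of additional items. -/
def rm : Expr := .reg 3

/-- The index of the current cell. -/
def rq : Expr := .reg 5

def one : Expr := .const 1

/-- The greatest common divisor of the values of all additional items, see `gcdR`. -/
def gcdExpr (a : Expr) : Expr := cell 4 (a * (rm + one) + rm)

/-- The initial envy, see `envy`. -/
def envyExpr (a b : Expr) : Expr := cell 5 ((a * rn + b) * (rp + one) + rp)

def mismatchTerm (a b r : Expr) : Expr :=
  cell 1 (a * rm + r) * gcdExpr b - cell 1 (b * rm + r) * gcdExpr a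

def envyTerm (a b j : Expr) : Expr :=
  cell 0 (a * rp + j) * (cell 2 (b * rp + j) - cell 2 (a * rp + j))

def relExpr (a b : Expr) : Expr := cell 7 (a * rn + b)

def longestExpr (k i j : Expr) : Expr := cell 8 ((k * rn + i) * rn + j)

def weightExpr (a b : Expr) : Expr := .const 0 - (.const 0 - envyExpr a b) / gcdExpr a

/-- Each agent owns a row of `m + 1` cells. The factor `pos` restarts the recurrence at the
beginning of a row; it also neutralizes the read at index `-1` when `q = 0`. -/
def gcdPhase : Prog :=
  phase 4 (rn * (rm + one)) (.pos (rq % (rm + one)) * cell 4 (rq - one))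
    (.pos (rq % (rm + one)) * cell 1 (rq / (rm + one) * rm + (rq % (rm + one) - one))) (.reg 6)

def envyPhase : Prog :=
  phase 5 (rn * rn * (rp + one)) (.const 0) (.const 0)
    (.pos (rq % (rp + one)) * (cell 5 (rq - one) +
      envyTerm (rq / (rp + one) / rn) (rq / (rp + one) % rn) (rq % (rp + one) - one)))

def mismatchPhase : Prog :=
  phase 6 (rn * rn * (rm + one)) (.const 0) (.const 0)
    (.pos (rq % (rm + one)) * (cell 6 (rq - one) +
      mismatchTerm (rq / (rm + one) / rn) (rq / (rm + one) % rn) (rq % (rm + one) - one) *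
      mismatchTerm (rq / (rm + one) / rn) (rq / (rm + one) % rn) (rq % (rm + one) - one)))

def relPhase : Prog :=
  phase 7 (rn * rn) (.const 0) (.const 0)
    (.pos (gcdExpr (rq / rn)) * .pos (gcdExpr (rq % rn)) *
      (one - .pos (cell 6 (rq * (rm + one) + rm))))

/-- `max x y - x` if `y - x` is the value of `e`. -/
def excess (e : Expr) : Expr := .pos e * e

def longestStep (k i j : Expr) : Expr :=
  longestExpr k i j + relExpr i k * relExpr k j *
    excess (longestExpr k i k + longestExpr k k j - longestExpr k i j)

/-- The two cases of the recursion are selected arithmetically: both are evaluated and one is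
multiplied by zero, so stray reads in layer zero do no harm. -/
def longestPhase : Prog :=
  phase 8 ((rn + one) * (rn * rn)) (.const 0) (.const 0)
    ((one - .pos (rq / (rn * rn))) * weightExpr (rq / rn % rn) (rq % rn) +
      .pos (rq / (rn * rn)) * longestStep (rq / (rn * rn) - one) (rq / rn % rn) (rq % rn))

def violationExpr (a b : Expr) : Expr :=
  (one - .pos (gcdExpr a)) * .pos (envyExpr a b) + relExpr a a * .pos (longestExpr rn a a)

def violationPhase : Prog :=
  phase 9 (rn * rn + one) (.const 0) (.const 0)
    (.pos rq * (cell 9 (rq - one) + violationExpr ((rq - one) / rn) ((rq - one) % rn)))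

/-! ### Evaluation of the expressions -/

section Eval

variable {k : ℕ} {s : State} {ea eb ej : Expr} {a b j : ℕ}

lemma Good.eval_rn (h : Good I k s) : rn.eval s = I.n := h.reg_n
lemma Good.eval_rp (h : Good I k s) : rp.eval s = I.p := h.reg_p
lemma Good.eval_rm (h : Good I k s) : rm.eval s = I.m := h.reg_m
lemma View.eval_rq {q : ℕ} (h : View I k q s) : rq.eval s = q := h.index
lemma eval_one : one.eval s = 1 := rfl

lemma eval_pred {e : Expr} {r : ℕ} (he : e.eval s = (r + 1 : ℕ)) : (e - one).eval s = r := by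
  rw [Expr.eval_sub, he, eval_one]
  push_cast
  ring

lemma mul_add_div_mod {a b j : ℕ} (hj : j < b) : (a * b + j) / b = a ∧ (a * b + j) % b = j := by
  constructor
  · rw [mul_comm, Nat.mul_add_div (by omega), Nat.div_eq_of_lt hj, add_zero]
  · rw [mul_comm, Nat.mul_add_mod, Nat.mod_eq_of_lt hj]

lemma Good.eval_gcdExpr (h : Good I k s) (hk : 4 < k) (ha : ea.eval s = a) (han : a < I.n) :
    (gcdExpr ea).eval s = I.gcdR a := by
  have h1 := mul_add_div_mod (a := a) (j := I.m) (b := I.m + 1) (by omega)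
  rw [gcdExpr, h.eval_cell hk (i := a * (I.m + 1) + I.m) (add_lt_mul han (by omega))]
  · simp only [content, h1, gcdR]
  · simp only [Expr.eval_add, Expr.eval_mul, ha, h.eval_rm, eval_one]
    push_cast; rfl

lemma Good.eval_envyExpr (h : Good I k s) (hk : 5 < k) (ha : ea.eval s = a) (han : a < I.n)
    (hb : eb.eval s = b) (hbn : b < I.n) : (envyExpr ea eb).eval s = I.envy a b := by
  have h1 := mul_add_div_mod (a := a * I.n + b) (j := I.p) (b := I.p + 1) (by omega)
  have h2 := mul_add_div_mod (a := a) hbn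
  rw [envyExpr, h.eval_cell hk (i := (a * I.n + b) * (I.p + 1) + I.p)
    (add_lt_mul (add_lt_mul han hbn) (by omega))]
  · simp only [content, h1, h2, envy]
  · simp only [Expr.eval_add, Expr.eval_mul, ha, hb, h.eval_rn, h.eval_rp, eval_one]
    push_cast; rfl

lemma Good.eval_weightExpr (h : Good I k s) (hk : 5 < k) (ha : ea.eval s = a) (han : a < I.n)
    (hb : eb.eval s = b) (hbn : b < I.n) : (weightExpr ea eb).eval s = I.weight a b := by
  simp only [weightExpr, Expr.eval_sub, Expr.eval_div, Expr.eval_const,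
    h.eval_envyExpr hk ha han hb hbn, h.eval_gcdExpr (by omega) ha han, weight, zero_sub]

lemma Good.eval_mismatchTerm (h : Good I k s) (hk : 4 < k) (ha : ea.eval s = a) (han : a < I.n)
    (hb : eb.eval s = b) (hbn : b < I.n) (hj : ej.eval s = j) (hjm : j < I.m) :
    (mismatchTerm ea eb ej).eval s =
      (I.valR a j : ℤ) * I.gcdR b - I.valR b j * I.gcdR a := by
  have key : ∀ (e : Expr) (x : ℕ), e.eval s = x → x < I.n →
      (cell 1 (e * rm + ej)).eval s = I.valR x j := by
    intro e x he hx
    rw [h.eval_cell (j := 1) (by omega) (i := x * I.m + j) (add_lt_mul hx hjm), content_one hx hjm]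
    simp only [Expr.eval_add, Expr.eval_mul, he, hj, h.eval_rm]
    push_cast; rfl
  simp only [mismatchTerm, Expr.eval_sub, Expr.eval_mul, key _ _ ha han, key _ _ hb hbn,
    h.eval_gcdExpr hk ha han, h.eval_gcdExpr hk hb hbn]

lemma Good.eval_envyTerm (h : Good I k s) (hk : 4 < k) (ha : ea.eval s = a) (han : a < I.n)
    (hb : eb.eval s = b) (hbn : b < I.n) (hj : ej.eval s = j) (hjp : j < I.p) :
    (envyTerm ea eb ej).eval s = (I.valP a j : ℤ) * (I.holds b j - I.holds a j) := by
  have key : ∀ (e : Expr) (x : ℕ), e.eval s = x →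
      (e * rp + ej).eval s = (x * I.p + j : ℕ) := by
    intro e x he
    simp only [Expr.eval_add, Expr.eval_mul, he, hj, h.eval_rp]
    push_cast; rfl
  simp only [envyTerm, Expr.eval_sub, Expr.eval_mul]
  rw [h.eval_cell (by omega) (add_lt_mul han hjp) (key _ _ ha), content_zero han hjp,
    h.eval_cell (by omega) (add_lt_mul han hjp) (key _ _ ha), content_two han hjp,
    h.eval_cell (by omega) (add_lt_mul hbn hjp) (key _ _ hb), content_two hbn hjp]

lemma Good.eval_relExpr (h : Good I k s) (hk : 7 < k) (ha : ea.eval s = a) (han : a < I.n)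
    (hb : eb.eval s = b) (hbn : b < I.n) :
    (relExpr ea eb).eval s = if I.Rel a b then 1 else 0 := by
  have h2 := mul_add_div_mod (a := a) hbn
  rw [relExpr, h.eval_cell hk (i := a * I.n + b) (add_lt_mul han hbn)]
  · simp only [content, h2]
  · simp only [Expr.eval_add, Expr.eval_mul, ha, hb, h.eval_rn]
    push_cast; rfl

lemma content_eight {k i j : ℕ} (hi : i < I.n) (hj : j < I.n) :
    I.content 8 ((k * I.n + i) * I.n + j) = longest I.Rel I.weight k i j := by
  have h1 := mul_add_div_mod (a := k * I.n + i) hj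
  have h2 := mul_add_div_mod (a := k) hi
  simp only [content, ← Nat.div_div_eq_div_mul, h1, h2]

end Eval

/-- Away from the beginning of a row, the preceding cell belongs to the same row. This links the
flat index to the recurrences on prefixes. -/
lemma pred_div_mod {q w r : ℕ} (h : q % (w + 1) = r + 1) :
    (q - 1) / (w + 1) = q / (w + 1) ∧ (q - 1) % (w + 1) = r ∧ 0 < q ∧ r < w := by
  have h1 := Nat.div_add_mod q (w + 1)
  have h2 := Nat.mod_lt q (by omega : 0 < w + 1)
  have h3 : q - 1 = q / (w + 1) * (w + 1) + r := by
    rw [h] at h1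
    rw [mul_comm]
    omega
  have h4 := mul_add_div_mod (a := q / (w + 1)) (b := w + 1) (j := r) (by omega)
  rw [← h3] at h4
  exact ⟨h4.1, h4.2, by by_contra h0; simp [Nat.eq_zero_of_not_pos h0] at h, by omega⟩

lemma gcdPhase_spec : ∃ K, ∀ I s, s.Bounded I.bits → Good I 4 s →
    ∃ s', RunsIn gcdPhase s (K * (I.bits + 1) ^ 3) s' ∧ s'.Bounded I.bits ∧ Good I 5 s' := by
  refine phase_spec 4 _ _ _ _ (fun I s h => ?_) (fun I => len_le_bits (by omega))
    (fun I => base_succ_le (by omega)) (fun I => content_natAbs_lt (by omega) (by omega))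
    (fun I q hq => ?_)
  · simp only [Expr.eval_mul, Expr.eval_add, h.eval_rn, h.eval_rm, eval_one, len]
    push_cast; rfl
  · have ha : q / (I.m + 1) < I.n := Nat.div_lt_of_lt_mul (by rw [mul_comm]; exact hq)
    have hb := lt_bits (I := I)
    have hpow : 2 ^ inputSize I.encode < 2 ^ I.bits :=
      Nat.pow_lt_pow_right (by norm_num) (by omega)
    have hr : ∀ s, View I 4 q s → (rq % (rm + one)).eval s = (q % (I.m + 1) : ℕ) :=
      fun s h => by
        simp only [Expr.eval_mod, Expr.eval_add, h.eval_rq, h.eval_rm, eval_one]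
        push_cast; rfl
    obtain hr0 | ⟨r, hr1⟩ : q % (I.m + 1) = 0 ∨ ∃ r, q % (I.m + 1) = r + 1 :=
      (Nat.eq_zero_or_eq_succ_pred _).imp_right fun h => ⟨_, h⟩
    -- At the beginning of a row both arguments are masked, and `gcd 0 0 = 0` is the empty gcd.
    · refine ⟨0, 0, by positivity, by positivity, fun s h => ?_⟩
      have hr' := hr s h
      rw [hr0] at hr'
      simp only [Expr.eval_mul, Expr.eval_pos, hr', Expr.eval_reg, content, hr0, prefixGcd]
      simp
    · obtain ⟨hd, hm, hq0, hrm⟩ := pred_div_mod hr1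
      refine ⟨I.prefixGcd (q / (I.m + 1)) r, I.valR (q / (I.m + 1)) r,
        (prefixGcd_lt _ _).trans hpow, (valR_lt _ _).trans hpow, fun s h => ?_⟩
      have hr' := hr s h
      rw [hr1] at hr'
      have e1 : (cell 4 (rq - one)).eval s = I.prefixGcd (q / (I.m + 1)) r := by
        rw [h.eval_cell_self (i := q - 1) (by omega)
          (eval_pred (by rw [h.eval_rq, Nat.sub_add_cancel hq0]))]
        simp only [content, hd, hm]
      have e2 : (cell 1 (rq / (rm + one) * rm + (rq % (rm + one) - one))).eval s =
          I.valR (q / (I.m + 1)) r := by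
        rw [h.eval_cell (j := 1) (by omega) (i := q / (I.m + 1) * I.m + r) (add_lt_mul ha hrm),
          content_one ha hrm]
        rw [Expr.eval_add, eval_pred hr']
        simp only [Expr.eval_mul, Expr.eval_div, Expr.eval_add, h.eval_rq, h.eval_rm, eval_one]
        push_cast; rfl
      have hpos : (0 : ℤ) < (r + 1 : ℕ) := Int.natCast_pos.2 (Nat.succ_pos r)
      simp only [Expr.eval_mul, Expr.eval_pos, hr', if_pos hpos, e1, e2, one_mul, true_and,
        Expr.eval_reg, content, hr1, prefixGcd]
      exact id

lemma envyPhase_spec : ∃ K, ∀ I s, s.Bounded I.bits → Good I 5 s →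
    ∃ s', RunsIn envyPhase s (K * (I.bits + 1) ^ 3) s' ∧ s'.Bounded I.bits ∧ Good I 6 s' := by
  refine phase_spec 5 _ _ _ _ (fun I s h => ?_) (fun I => len_le_bits (by omega))
    (fun I => base_succ_le (by omega)) (fun I => content_natAbs_lt (by omega) (by omega))
    (fun I q hq => ⟨0, 0, by positivity, by positivity, fun s h => ⟨rfl, rfl, fun _ => ?_⟩⟩)
  · simp only [Expr.eval_mul, Expr.eval_add, h.eval_rn, h.eval_rp, eval_one, len]
    push_cast; rfl
  · have hc : q / (I.p + 1) < I.n * I.n := Nat.div_lt_of_lt_mul (by rw [mul_comm]; exact hq)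
    have ha : q / (I.p + 1) / I.n < I.n := Nat.div_lt_of_lt_mul hc
    have hb : q / (I.p + 1) % I.n < I.n := Nat.mod_lt _ (Nat.zero_lt_of_lt ha)
    have hr : (rq % (rp + one)).eval s = (q % (I.p + 1) : ℕ) := by
      simp only [Expr.eval_mod, Expr.eval_add, h.eval_rq, h.eval_rp, eval_one]
      push_cast; rfl
    have hea : (rq / (rp + one) / rn).eval s = (q / (I.p + 1) / I.n : ℕ) := by
      simp only [Expr.eval_div, Expr.eval_add, h.eval_rq, h.eval_rp, h.eval_rn, eval_one]
      push_cast; rfl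
    have heb : (rq / (rp + one) % rn).eval s = (q / (I.p + 1) % I.n : ℕ) := by
      simp only [Expr.eval_div, Expr.eval_mod, Expr.eval_add, h.eval_rq, h.eval_rp, h.eval_rn,
        eval_one]
      push_cast; rfl
    obtain hr0 | ⟨r, hr1⟩ : q % (I.p + 1) = 0 ∨ ∃ r, q % (I.p + 1) = r + 1 :=
      (Nat.eq_zero_or_eq_succ_pred _).imp_right fun h => ⟨_, h⟩
    · rw [hr0] at hr
      rw [Expr.eval_mul, Expr.eval_pos, hr]
      simp [content, hr0, prefixEnvy]
    · obtain ⟨hd, hm, hq0, hrm⟩ := pred_div_mod hr1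
      rw [hr1] at hr
      have hpos : (0 : ℤ) < (r + 1 : ℕ) := Int.natCast_pos.2 (Nat.succ_pos r)
      rw [Expr.eval_mul, Expr.eval_pos, hr, if_pos hpos, one_mul, Expr.eval_add,
        h.eval_cell_self (i := q - 1) (by omega)
          (eval_pred (by rw [h.eval_rq, Nat.sub_add_cancel hq0])),
        h.eval_envyTerm (by omega) hea ha heb hb (eval_pred hr) hrm]
      simp only [content, hd, hm, hr1, prefixEnvy, Finset.sum_range_succ]

lemma mismatchPhase_spec : ∃ K, ∀ I s, s.Bounded I.bits → Good I 6 s →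
    ∃ s', RunsIn mismatchPhase s (K * (I.bits + 1) ^ 3) s' ∧ s'.Bounded I.bits ∧
      Good I 7 s' := by
  refine phase_spec 6 _ _ _ _ (fun I s h => ?_) (fun I => len_le_bits (by omega))
    (fun I => base_succ_le (by omega)) (fun I => content_natAbs_lt (by omega) (by omega))
    (fun I q hq => ⟨0, 0, by positivity, by positivity, fun s h => ⟨rfl, rfl, fun _ => ?_⟩⟩)
  · simp only [Expr.eval_mul, Expr.eval_add, h.eval_rn, h.eval_rm, eval_one, len]
    push_cast; rfl
  · have hc : q / (I.m + 1) < I.n * I.n := Nat.div_lt_of_lt_mul (by rw [mul_comm]; exact hq)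
    have ha : q / (I.m + 1) / I.n < I.n := Nat.div_lt_of_lt_mul hc
    have hb : q / (I.m + 1) % I.n < I.n := Nat.mod_lt _ (Nat.zero_lt_of_lt ha)
    have hr : (rq % (rm + one)).eval s = (q % (I.m + 1) : ℕ) := by
      simp only [Expr.eval_mod, Expr.eval_add, h.eval_rq, h.eval_rm, eval_one]
      push_cast; rfl
    have hea : (rq / (rm + one) / rn).eval s = (q / (I.m + 1) / I.n : ℕ) := by
      simp only [Expr.eval_div, Expr.eval_add, h.eval_rq, h.eval_rm, h.eval_rn, eval_one]
      push_cast; rfl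
    have heb : (rq / (rm + one) % rn).eval s = (q / (I.m + 1) % I.n : ℕ) := by
      simp only [Expr.eval_div, Expr.eval_mod, Expr.eval_add, h.eval_rq, h.eval_rm, h.eval_rn,
        eval_one]
      push_cast; rfl
    obtain hr0 | ⟨r, hr1⟩ : q % (I.m + 1) = 0 ∨ ∃ r, q % (I.m + 1) = r + 1 :=
      (Nat.eq_zero_or_eq_succ_pred _).imp_right fun h => ⟨_, h⟩
    · rw [hr0] at hr
      rw [Expr.eval_mul, Expr.eval_pos, hr]
      simp [content, hr0, prefixMismatch]
    · obtain ⟨hd, hm, hq0, hrm⟩ := pred_div_mod hr1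
      rw [hr1] at hr
      have hpos : (0 : ℤ) < (r + 1 : ℕ) := Int.natCast_pos.2 (Nat.succ_pos r)
      rw [Expr.eval_mul, Expr.eval_pos, hr, if_pos hpos, one_mul, Expr.eval_add, Expr.eval_mul,
        h.eval_cell_self (i := q - 1) (by omega)
          (eval_pred (by rw [h.eval_rq, Nat.sub_add_cancel hq0])),
        h.eval_mismatchTerm (by omega) hea ha heb hb (eval_pred hr) hrm]
      simp only [content, hd, hm, hr1, prefixMismatch, Finset.sum_range_succ, pow_two]

lemma relPhase_spec : ∃ K, ∀ I s, s.Bounded I.bits → Good I 7 s →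
    ∃ s', RunsIn relPhase s (K * (I.bits + 1) ^ 3) s' ∧ s'.Bounded I.bits ∧ Good I 8 s' := by
  refine phase_spec 7 _ _ _ _ (fun I s h => ?_) (fun I => len_le_bits (by omega))
    (fun I => base_succ_le (by omega)) (fun I => content_natAbs_lt (by omega) (by omega))
    (fun I q hq => ⟨0, 0, by positivity, by positivity, fun s h => ⟨rfl, rfl, fun _ => ?_⟩⟩)
  · simp only [Expr.eval_mul, h.eval_rn, len]
    push_cast; rfl
  · have ha : q / I.n < I.n := Nat.div_lt_of_lt_mul hq
    have hb : q % I.n < I.n := Nat.mod_lt _ (Nat.zero_lt_of_lt ha)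
    have hea : (rq / rn).eval s = (q / I.n : ℕ) := by
      simp only [Expr.eval_div, h.eval_rq, h.eval_rn]
      push_cast; rfl
    have heb : (rq % rn).eval s = (q % I.n : ℕ) := by
      simp only [Expr.eval_mod, h.eval_rq, h.eval_rn]
      push_cast; rfl
    have hX : (cell 6 (rq * (rm + one) + rm)).eval s =
        I.prefixMismatch (q / I.n) (q % I.n) I.m := by
      have h1 := mul_add_div_mod (a := q) (j := I.m) (b := I.m + 1) (by omega)
      rw [h.eval_cell (by omega) (i := q * (I.m + 1) + I.m) (add_lt_mul hq (by omega))]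
      · simp only [content, h1]
      · simp only [Expr.eval_add, Expr.eval_mul, h.eval_rq, h.eval_rm, eval_one]
        push_cast; rfl
    simp only [Expr.eval_mul, Expr.eval_pos, Expr.eval_sub, hX, eval_one,
      h.eval_gcdExpr (by omega) hea ha, h.eval_gcdExpr (by omega) heb hb, content, Rel,
      ← not_lt (a := (0 : ℤ)), Nat.cast_pos]
    split_ifs <;> first | rfl | tauto

lemma longestPhase_spec : ∃ K, ∀ I s, s.Bounded I.bits → Good I 8 s →
    ∃ s', RunsIn longestPhase s (K * (I.bits + 1) ^ 3) s' ∧ s'.Bounded I.bits ∧ Good I 9 s' := by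
  refine phase_spec 8 _ _ _ _ (fun I s h => ?_) (fun I => len_le_bits (by omega))
    (fun I => base_succ_le (by omega)) (fun I => content_natAbs_lt (by omega) (by omega))
    (fun I q hq => ⟨0, 0, by positivity, by positivity, fun s h => ⟨rfl, rfl, fun _ => ?_⟩⟩)
  · simp only [Expr.eval_mul, Expr.eval_add, h.eval_rn, eval_one, len]
    push_cast; rfl
  · have hn : 0 < I.n := by
      rcases Nat.eq_zero_or_pos I.n with h0 | h0
      · simp [len, h0] at hq
      · exact h0
    have hi : q / I.n % I.n < I.n := Nat.mod_lt _ hn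
    have hj : q % I.n < I.n := Nat.mod_lt _ hn
    have hkn : q / (I.n * I.n) < I.n + 1 := Nat.div_lt_of_lt_mul (by rw [mul_comm]; exact hq)
    have hei : (rq / rn % rn).eval s = (q / I.n % I.n : ℕ) := by
      simp only [Expr.eval_div, Expr.eval_mod, h.eval_rq, h.eval_rn]
      push_cast; rfl
    have hej : (rq % rn).eval s = (q % I.n : ℕ) := by
      simp only [Expr.eval_mod, h.eval_rq, h.eval_rn]
      push_cast; rfl
    have hek : (rq / (rn * rn)).eval s = (q / (I.n * I.n) : ℕ) := by
      simp only [Expr.eval_div, Expr.eval_mul, h.eval_rq, h.eval_rn]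
      push_cast; rfl
    have hq' : q = (q / (I.n * I.n) * I.n + q / I.n % I.n) * I.n + q % I.n := by
      rw [← Nat.div_div_eq_div_mul, mul_comm (q / I.n / I.n), Nat.div_add_mod, mul_comm,
        Nat.div_add_mod]
    simp only [content]
    generalize q / (I.n * I.n) = k at *
    generalize q / I.n % I.n = i at *
    generalize q % I.n = j at *
    rw [Expr.eval_add, Expr.eval_mul, Expr.eval_mul, Expr.eval_sub, Expr.eval_pos, hek, eval_one]
    rcases k with _ | k
    · rw [h.eval_weightExpr (by omega) hei hi hej hj]
      simp [longest]
    · have hpos : (0 : ℤ) < (k + 1 : ℕ) := Int.natCast_pos.2 (Nat.succ_pos k)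
      have hek' := eval_pred hek
      have key : ∀ (e f : Expr) (x y : ℕ), e.eval s = x → f.eval s = y → x < I.n → y < I.n →
          (longestExpr (rq / (rn * rn) - one) e f).eval s = longest I.Rel I.weight k x y := by
        intro e f x y he hf hx hy
        rw [longestExpr, h.eval_cell_self (i := (k * I.n + x) * I.n + y), content_eight hx hy]
        -- All of layer `k` precedes the current cell of layer `k + 1`, so it has already been
        -- written.
        · rw [hq']
          calc (k * I.n + x) * I.n + y < (k * I.n + x + 1) * I.n := by
                rw [add_mul _ 1]; omega
            _ ≤ ((k + 1) * I.n + i) * I.n := by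
                refine Nat.mul_le_mul_right _ ?_
                rw [add_mul, one_mul]; omega
            _ ≤ _ := Nat.le_add_right _ _
        · simp only [Expr.eval_add, Expr.eval_mul, h.eval_rn, hek', he, hf]
          push_cast; rfl
      have hkn' : k < I.n := by omega
      rw [if_pos hpos]
      simp only [longestStep, excess, Expr.eval_add, Expr.eval_mul, Expr.eval_sub, Expr.eval_pos,
        key _ _ _ _ hei hej hi hj, key _ _ _ _ hei hek' hi hkn', key _ _ _ _ hek' hej hkn' hj,
        h.eval_relExpr (by omega) hei hi hek' hkn', h.eval_relExpr (by omega) hek' hkn' hej hj,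
        longest]
      -- Only the case where both relations hold survives; there `max x y = x + max 0 (y - x)`.
      by_cases h1 : I.Rel i k <;> by_cases h2 : I.Rel k j <;> simp only [h1, h2] <;>
        simp
      split_ifs with h3
      · rw [max_eq_right (by omega)]; ring
      · rw [max_eq_left (by omega)]; ring

lemma violationPhase_spec : ∃ K, ∀ I s, s.Bounded I.bits → Good I 9 s →
    ∃ s', RunsIn violationPhase s (K * (I.bits + 1) ^ 3) s' ∧ s'.Bounded I.bits ∧
      Good I 10 s' := by
  refine phase_spec 9 _ _ _ _ (fun I s h => ?_) (fun I => len_le_bits (by omega))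
    (fun I => base_succ_le (by omega)) (fun I => content_natAbs_lt (by omega) (by omega))
    (fun I q hq => ⟨0, 0, by positivity, by positivity, fun s h => ⟨rfl, rfl, fun _ => ?_⟩⟩)
  · simp only [Expr.eval_mul, Expr.eval_add, h.eval_rn, eval_one, len]
    push_cast; rfl
  · rcases q with _ | q
    · rw [Expr.eval_mul, Expr.eval_pos, h.eval_rq]
      simp [content]
    · have hq : q < I.n * I.n := by simpa [len] using hq
      have hpos : (0 : ℤ) < (q + 1 : ℕ) := Int.natCast_pos.2 (Nat.succ_pos q)
      have hu := eval_pred h.eval_rq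
      have ha : q / I.n < I.n := Nat.div_lt_of_lt_mul hq
      have hb : q % I.n < I.n := Nat.mod_lt _ (Nat.zero_lt_of_lt ha)
      have hea : ((rq - one) / rn).eval s = (q / I.n : ℕ) := by
        rw [Expr.eval_div, hu, h.eval_rn]
        push_cast; rfl
      have heb : ((rq - one) % rn).eval s = (q % I.n : ℕ) := by
        rw [Expr.eval_mod, hu, h.eval_rn]
        push_cast; rfl
      have hD : (longestExpr rn ((rq - one) / rn) ((rq - one) / rn)).eval s =
          longest I.Rel I.weight I.n (q / I.n) (q / I.n) := by
        rw [longestExpr, h.eval_cell (by omega) (i := (I.n * I.n + q / I.n) * I.n + q / I.n),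
          content_eight ha ha]
        · have : (I.n + 1) * (I.n * I.n) = (I.n * I.n + I.n) * I.n := by ring
          rw [len, this]
          exact add_lt_mul (by omega) ha
        · simp only [Expr.eval_add, Expr.eval_mul, h.eval_rn, hea]
          push_cast; rfl
      rw [Expr.eval_mul, Expr.eval_pos, h.eval_rq, if_pos hpos, one_mul, Expr.eval_add,
        h.eval_cell_self (i := q) (by omega) hu]
      simp only [violationExpr, Expr.eval_add, Expr.eval_mul, Expr.eval_sub, Expr.eval_pos, hD,
        h.eval_relExpr (by omega) hea ha hea ha, h.eval_envyExpr (by omega) hea ha heb hb,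
        h.eval_gcdExpr (by omega) hea ha, eval_one, content, Finset.sum_range_succ, violation]
      congr 1
      congr 1
      · rcases Nat.eq_zero_or_pos (I.gcdR (q / I.n)) with h0 | h0
        · simp [h0]
        · simp [h0, h0.ne']
      · split_ifs <;> simp_all

end EnvyElimination.Inst

namespace EnvyElimination.Inst

open RAM

variable {I : Inst}

/-! ### Correctness of the criterion -/

lemma valR_fin (a : Fin I.n) (r : Fin I.m) : I.valR a r = I.v a (.inr r) :=
  dif_pos ⟨a.2, r.2⟩

lemma prefixGcd_dvd (a : ℕ) : ∀ r, ∀ i < r, I.prefixGcd a r ∣ I.valR a i := by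
  intro r
  induction r with
  | zero => intro i hi; omega
  | succ r ih =>
    intro i hi
    rw [prefixGcd]
    rcases Nat.lt_succ_iff_lt_or_eq.1 hi with h | rfl
    · exact (Nat.gcd_dvd_left _ _).trans (ih i h)
    · exact Nat.gcd_dvd_right _ _

/-- Bezout by induction: rescale the old coefficients by `gcdA` and give the new item the
coefficient `gcdB`. -/
lemma exists_sum_eq_prefixGcd (a : ℕ) :
    ∀ r, ∃ z : ℕ → ℤ, ∑ i ∈ Finset.range r, z i * I.valR a i = I.prefixGcd a r := by
  intro r
  induction r with
  | zero => exact ⟨0, by simp [prefixGcd]⟩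
  | succ r ih =>
    obtain ⟨z, hz⟩ := ih
    let x := Nat.gcdA (I.prefixGcd a r) (I.valR a r)
    let y := Nat.gcdB (I.prefixGcd a r) (I.valR a r)
    refine ⟨fun i => if i < r then x * z i else y, ?_⟩
    rw [Finset.sum_range_succ, prefixGcd, Nat.gcd_eq_gcd_ab, ← hz, Finset.sum_mul]
    congr 1
    · refine Finset.sum_congr rfl fun i hi => ?_
      simp only [if_pos (Finset.mem_range.1 hi), x]
      ring
    · simp only [lt_irrefl, if_false, y]
      ring

/-- A sum of squares is nonpositive only if every square vanishes, so one number tests all cross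
products. -/
lemma rel_iff (a b : ℕ) : I.Rel a b ↔
    0 < I.gcdR a ∧ 0 < I.gcdR b ∧ ∀ r < I.m, I.valR a r * I.gcdR b = I.valR b r * I.gcdR a := by
  rw [Rel]
  refine and_congr_right fun _ => and_congr_right fun _ => ?_
  have h0 : 0 ≤ I.prefixMismatch a b I.m := Finset.sum_nonneg fun _ _ => sq_nonneg _
  rw [h0.ge_iff_eq', prefixMismatch,
    Finset.sum_eq_zero_iff_of_nonneg fun _ _ => sq_nonneg _]
  refine forall_congr' fun r => ?_
  rw [Finset.mem_range, pow_eq_zero_iff two_ne_zero, sub_eq_zero]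
  exact imp_congr_right fun _ => by exact_mod_cast Iff.rfl

instance : Std.Symm I.Rel where
  symm a b h := by
    rw [rel_iff] at *
    exact ⟨h.2.1, h.1, fun r hr => (h.2.2 r hr).symm⟩

/-- The positive gcd in the middle is cancelled. Without positivity the zero valuation would be
proportional to everything and transitivity would fail. -/
instance : IsTrans ℕ I.Rel where
  trans a b c h h' := by
    rw [rel_iff] at *
    refine ⟨h.1, h'.2.1, fun r hr => ?_⟩
    have h1 := h.2.2 r hr
    have h2 := h'.2.2 r hr
    refine Nat.eq_of_mul_eq_mul_right h.2.1 ?_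
    linear_combination I.gcdR c * h1 + I.gcdR a * h2

lemma proportional_iff (a b : Fin I.n) :
    Proportional (fun (a : Fin I.n) r => I.v a (.inr r)) (fun a => I.gcdR a) a b ↔
      I.Rel a b := by
  rw [rel_iff, Proportional]
  simp only [← valR_fin]
  exact and_congr_right fun _ => and_congr_right fun _ =>
    ⟨fun h r hr => h ⟨r, hr⟩, fun h r => h r r.2⟩

lemma envy_eq (a b : Fin I.n) :
    I.envy a b = (I.initialValue a b : ℤ) - I.initialValue a a := by
  have h : ∀ b : Fin I.n, (I.initialValue a b : ℤ) =
      ∑ j : Fin I.p, (I.valP a j : ℤ) * I.holds b j := by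
    intro b
    have hv : ∀ j : Fin I.p, I.valP a j = I.v a (.inl j) := fun j => dif_pos ⟨a.2, j.2⟩
    have hh : ∀ j : Fin I.p, I.holds b j = if j ∈ I.σ b then 1 else 0 :=
      fun j => dif_pos ⟨b.2, j.2⟩
    simp [initialValue, hv, hh]
  rw [envy, prefixEnvy, Finset.sum_range, h, h, ← Finset.sum_sub_distrib]
  exact Finset.sum_congr rfl fun j _ => mul_sub _ _ _

/-- There are no violations. -/
def Criterion (I : Inst) : Prop :=
  ∀ a < I.n, (∀ b < I.n, ¬ (I.gcdR a = 0 ∧ 0 < I.envy a b)) ∧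
    ¬ (I.Rel a a ∧ 0 < longest I.Rel I.weight I.n a a)

lemma isYes_iff (hs : ∀ r, I.supply r = ⊤) (hb : I.budget = ⊤) :
    I.IsYes ↔ ∃ ρ : Fin I.n → Fin I.m → ℕ, ∀ a b : Fin I.n,
      I.envy a b ≤ ∑ r, ((ρ a r : ℤ) - ρ b r) * I.v a (.inr r) := by
  refine exists_congr fun ρ => ?_
  have h1 : I.IsExtension ρ := fun r => by rw [hs]; exact le_top
  simp only [h1, hb, le_top, true_and, EnvyFree]
  refine forall_congr' fun a => forall_congr' fun b => ?_
  rw [Envies, not_lt, envy_eq]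
  simp only [addedValue, sub_mul, Finset.sum_sub_distrib]
  zify
  constructor <;> intro h <;> linarith

theorem isYes_iff_criterion (hs : ∀ r, I.supply r = ⊤) (hb : I.budget = ⊤) :
    I.IsYes ↔ I.Criterion := by
  rw [isYes_iff hs hb, exists_extension_iff (fun (a : Fin I.n) r => I.v a (.inr r))
    (fun a b => I.envy a b) (fun a => I.gcdR a)
    (fun a r => by rw [← valR_fin]; exact prefixGcd_dvd a I.m r r.2)
    (fun a => by
      obtain ⟨z, hz⟩ := exists_sum_eq_prefixGcd (I := I) a I.m
      refine ⟨fun r => z r, ?_⟩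
      rw [Finset.sum_range] at hz
      simp only [← valR_fin]
      exact hz)]
  simp only [proportional_iff]
  have h : (∃ y : Fin I.n → ℤ, ∀ a b : Fin I.n, I.Rel a b →
      -(-I.envy a b / I.gcdR a) ≤ y a - y b) ↔
      ∃ y : ℕ → ℤ, ∀ i < I.n, ∀ j < I.n, I.Rel i j → I.weight i j ≤ y i - y j := by
    constructor
    · rintro ⟨y, hy⟩
      refine ⟨fun i => if h : i < I.n then y ⟨i, h⟩ else 0, fun i hi j hj hij => ?_⟩
      simp only [dif_pos hi, dif_pos hj]
      exact hy ⟨i, hi⟩ ⟨j, hj⟩ hij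
    · rintro ⟨y, hy⟩
      exact ⟨fun a => y a, fun a b => hy a a.2 b b.2⟩
  rw [h, exists_potential_iff]
  constructor
  · rintro ⟨h1, h2⟩ a ha
    exact ⟨fun b hb h => (h1 ⟨a, ha⟩ ⟨b, hb⟩ h.1).not_gt h.2,
      fun h => (h2 a ha h.1).not_gt h.2⟩
  · intro h
    exact ⟨fun a b ha => not_lt.1 fun h' => (h a a.2).1 b b.2 ⟨ha, h'⟩,
      fun a ha haa => not_lt.1 fun h' => (h a ha).2 ⟨haa, h'⟩⟩

/-- All violations are nonnegative, so their total is positive iff one occurs. The diagonal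
condition for `a` is counted once for each `b`, which does not affect the sign. -/
lemma content_nine_pos_iff : 0 < I.content 9 (I.n * I.n) ↔ ¬ I.Criterion := by
  have hnn : ∀ a b, 0 ≤ I.violation a b := fun a b => by
    rw [violation]; split_ifs <;> simp
  have hz : ∀ a b, I.violation a b = 0 ↔ ¬ (I.gcdR a = 0 ∧ 0 < I.envy a b) ∧
      ¬ (I.Rel a a ∧ 0 < longest I.Rel I.weight I.n a a) := fun a b => by
    rw [violation]
    split_ifs with h1 h2 h2 <;> simp [h1, h2]
  have h0 : 0 ≤ I.content 9 (I.n * I.n) := Finset.sum_nonneg fun i _ => hnn _ _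
  rw [← not_iff_not, not_not, not_lt, h0.ge_iff_eq']
  simp only [content]
  rw [Finset.sum_eq_zero_iff_of_nonneg fun i _ => hnn _ _]
  constructor
  · intro h a ha
    have key : ∀ b < I.n, I.violation a b = 0 := fun b hb => by
      have := h (a * I.n + b) (Finset.mem_range.2 (add_lt_mul ha hb))
      rwa [(mul_add_div_mod hb).1, (mul_add_div_mod hb).2] at this
    exact ⟨fun b hb => ((hz a b).1 (key b hb)).1, ((hz a a).1 (key a ha)).2⟩
  · intro h i hi
    have ha : i / I.n < I.n := Nat.div_lt_of_lt_mul (Finset.mem_range.1 hi)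
    exact (hz _ _).2 ⟨(h _ ha).1 _ (Nat.mod_lt _ (Nat.zero_lt_of_lt ha)), (h _ ha).2⟩

/-! ### The complete program -/

/-- Read the numbers of agents and items and compute the addresses of the parts of the input. -/
def setup : Prog :=
  .seq (.assign 1 (.mem (.const 0))) (.seq (.assign 2 (.mem (.const 1)))
    (.seq (.assign 3 (.mem (.const 2))) (.seq (.assign 10 (.const 4 + rm))
      (.seq (.assign 11 (.reg 10 + rn * rp)) (.seq (.assign 12 (.reg 11 + rn * rm))
        (.seq (.assign 13 (.reg 12 + rn * rp)) (.assign 14 (.reg 0))))))))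

lemma bounded_init : (init I.encode).Bounded I.bits := by
  have hb := lt_bits (I := I)
  have hpow : 2 ^ inputSize I.encode < 2 ^ I.bits :=
    Nat.pow_lt_pow_right (by norm_num) (by omega)
  constructor
  · intro i
    simp only [init]
    split_ifs
    · rw [Int.natAbs_natCast]
      exact (length_le_inputSize _).trans_lt (Nat.lt_two_pow_self.trans hpow)
    · simp
  · intro j
    simp only [init]
    split_ifs
    · rw [Int.natAbs_natCast]
      exact (getD_lt _ _).trans hpow
    · simp

lemma init_mem (i : ℕ) : (init I.encode).mem i = (I.encode.getD i 0 : ℕ) := by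
  simp [init]

lemma setup_spec : ∃ K, ∀ I : Inst, ∃ s', RunsIn setup (init I.encode) (K * (I.bits + 1) ^ 3) s' ∧
    s'.Bounded I.bits ∧ Good I 4 s' := by
  obtain ⟨K₁, h₁⟩ := Expr.exists_cost_le (.mem (.const 0))
  obtain ⟨K₂, h₂⟩ := Expr.exists_cost_le (.mem (.const 1))
  obtain ⟨K₃, h₃⟩ := Expr.exists_cost_le (.mem (.const 2))
  obtain ⟨K₄, h₄⟩ := Expr.exists_cost_le (.const 4 + rm)
  obtain ⟨K₅, h₅⟩ := Expr.exists_cost_le (.reg 10 + rn * rp)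
  obtain ⟨K₆, h₆⟩ := Expr.exists_cost_le (.reg 11 + rn * rm)
  obtain ⟨K₇, h₇⟩ := Expr.exists_cost_le (.reg 12 + rn * rp)
  obtain ⟨K₈, h₈⟩ := Expr.exists_cost_le (.reg 0)
  refine ⟨K₁ + K₂ + K₃ + K₄ + K₅ + K₆ + K₇ + K₈ + 15, fun I => ?_⟩
  have hb := lt_bits (I := I)
  have hbase : ∀ j ≤ 4, I.base j ≤ I.bits := fun j hj => by
    have h1 := base_mono (I := I) hj
    have h2 := base_four_le (I := I)
    omega
  have m0 : (init I.encode).mem 0 = I.n := by simp [init, encode]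
  have m1 : (init I.encode).mem 1 = I.p := by simp [init, encode]
  have m2 : (init I.encode).mem 2 = I.m := by simp [init, encode]
  obtain ⟨r₁, b₁⟩ := RunsIn.assign_of_eval (i := 1) (x := I.n) h₁ bounded_init
    (by have := n_le (I := I); omega) m0
  obtain ⟨r₂, b₂⟩ := RunsIn.assign_of_eval (i := 2) (x := I.p) h₂ b₁
    (by have := p_le (I := I); omega) m1
  obtain ⟨r₃, b₃⟩ := RunsIn.assign_of_eval (i := 3) (x := I.m) h₃ b₂
    (by have := m_le (I := I); omega) m2
  obtain ⟨r₄, b₄⟩ := RunsIn.assign_of_eval (i := 10) (x := I.base 0) h₄ b₃ (hbase 0 (by omega))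
    (by simp [Expr.eval_add, Expr.eval_const, rm, Expr.eval_reg, State.setReg_reg, base])
  obtain ⟨r₅, b₅⟩ := RunsIn.assign_of_eval (i := 11) (x := I.base 1) h₅ b₄ (hbase 1 (by omega))
    (by simp [Expr.eval_add, Expr.eval_mul, rn, rp, Expr.eval_reg, State.setReg_reg, base, len])
  obtain ⟨r₆, b₆⟩ := RunsIn.assign_of_eval (i := 12) (x := I.base 2) h₆ b₅ (hbase 2 (by omega))
    (by simp [Expr.eval_add, Expr.eval_mul, rn, rm, Expr.eval_reg, State.setReg_reg, base, len])
  obtain ⟨r₇, b₇⟩ := RunsIn.assign_of_eval (i := 13) (x := I.base 3) h₇ b₆ (hbase 3 (by omega))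
    (by simp [Expr.eval_add, Expr.eval_mul, rn, rp, Expr.eval_reg, State.setReg_reg, base, len])
  -- Register `0` still holds the input length, which is the address of the first free cell by
  -- `length_encode`.
  obtain ⟨r₈, b₈⟩ := RunsIn.assign_of_eval (i := 14) (x := I.base 4) h₈ b₇ (hbase 4 (by omega))
    (by
      rw [← length_encode]
      simp [Expr.eval_reg, State.setReg_reg, init])
  refine ⟨_, (r₁.seq (r₂.seq (r₃.seq (r₄.seq (r₅.seq (r₆.seq (r₇.seq r₈))))))).mono ?_, b₈,
    ⟨?_, ?_, ?_, ?_, ?_⟩⟩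
  · have hX : I.bits + 1 ≤ (I.bits + 1) ^ 3 := Nat.le_self_pow (by norm_num) _
    have := Nat.mul_le_mul_left (K₁ + K₂ + K₃ + K₄ + K₅ + K₆ + K₇ + K₈) hX
    simp only [add_mul] at *
    omega
  · simp [State.setReg_reg]
  · simp [State.setReg_reg]
  · simp [State.setReg_reg]
  · intro j hj
    interval_cases j <;> simp [State.setReg_reg]
  · intro j hj i hi
    simp only [State.setReg_mem]
    rw [init_mem]
    interval_cases j <;> rfl

def program : Prog :=
  .seq setup (.seq gcdPhase (.seq envyPhase (.seq mismatchPhase (.seq relPhase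
    (.seq longestPhase (.seq violationPhase
      (.assign 0 (one - .pos (cell 9 (rn * rn))))))))))

lemma program_spec : ∃ K, ∀ I : Inst, ∃ s',
    RunsIn program (init I.encode) (K * (I.bits + 1) ^ 3) s' ∧ (s'.reg 0 = 1 ↔ I.Criterion) := by
  obtain ⟨K₃, h₃⟩ := setup_spec
  obtain ⟨K₄, h₄⟩ := gcdPhase_spec
  obtain ⟨K₅, h₅⟩ := envyPhase_spec
  obtain ⟨K₆, h₆⟩ := mismatchPhase_spec
  obtain ⟨K₇, h₇⟩ := relPhase_spec
  obtain ⟨K₈, h₈⟩ := longestPhase_spec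
  obtain ⟨K₉, h₉⟩ := violationPhase_spec
  obtain ⟨K, h⟩ := Expr.exists_cost_le (one - .pos (cell 9 (rn * rn)))
  refine ⟨K₃ + K₄ + K₅ + K₆ + K₇ + K₈ + K₉ + K + 8, fun I => ?_⟩
  obtain ⟨s₃, r₃, b₃, g₃⟩ := h₃ I
  obtain ⟨s₄, r₄, b₄, g₄⟩ := h₄ I s₃ b₃ g₃
  obtain ⟨s₅, r₅, b₅, g₅⟩ := h₅ I s₄ b₄ g₄
  obtain ⟨s₆, r₆, b₆, g₆⟩ := h₆ I s₅ b₅ g₅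
  obtain ⟨s₇, r₇, b₇, g₇⟩ := h₇ I s₆ b₆ g₆
  obtain ⟨s₈, r₈, b₈, g₈⟩ := h₈ I s₇ b₇ g₇
  obtain ⟨s₉, r₉, b₉, g₉⟩ := h₉ I s₈ b₈ g₈
  have r := RunsIn.assign 0 (one - .pos (cell 9 (rn * rn))) s₉
  have c := (h I.bits s₉ b₉).2
  refine ⟨_, (r₃.seq (r₄.seq (r₅.seq (r₆.seq (r₇.seq (r₈.seq (r₉.seq r))))))).mono ?_, ?_⟩
  · have hX : I.bits + 1 ≤ (I.bits + 1) ^ 3 := Nat.le_self_pow (by norm_num) _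
    have hK := Nat.mul_le_mul_left K hX
    simp only [add_mul]
    omega
  · have hc : (cell 9 (rn * rn)).eval s₉ = I.content 9 (I.n * I.n) := by
      refine g₉.eval_cell (by omega) (by simp [len]) ?_
      rw [Expr.eval_mul, g₉.eval_rn]
      push_cast
      rfl
    rw [State.setReg_reg, if_pos rfl, Expr.eval_sub, Expr.eval_pos, hc, eval_one]
    by_cases hC : I.Criterion
    · rw [if_neg (by rw [content_nine_pos_iff]; tauto)]
      simpa using hC
    · rw [if_pos (content_nine_pos_iff.2 hC)]
      simpa using hC

end EnvyElimination.Inst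

/-! ### The main theorem -/

theorem mainTheorem1 :
    RAM.PolyTimeDecidable EnvyElimination.Inst.encode
      (fun I => (∀ r, I.supply r = ⊤) ∧ I.budget = ⊤)
      EnvyElimination.Inst.IsYes := by
  obtain ⟨K, hK⟩ := EnvyElimination.Inst.program_spec
  refine ⟨EnvyElimination.Inst.program,
    Polynomial.C K * (7 * (Polynomial.X + 1) ^ 3 + 1) ^ 3, fun I hI => ?_⟩
  obtain ⟨s, ⟨t, ht, hr⟩, hs⟩ := hK I
  refine ⟨t, s, hr, ht.trans (le_of_eq ?_),
    hs.trans (EnvyElimination.Inst.isYes_iff_criterion hI.1 hI.2).symm⟩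
  simp [EnvyElimination.Inst.bits]
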